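/- Let $M$ be a (finite-dimensional, Hausdorff) complex manifold with complex structure $J$, and let $g$ be a smooth Kähler metric on $M$: $g(J\cdot,J\cdot)=g$ and the two-form $\omega(\cdot,\cdot)=g(J\cdot,\cdot)$ is closed. Assume that all sectional curvatures of $g$ are nonpositive. Let $\iota\colon L\to M$ be an immersed submanifold ($L$ a smooth second countable Hausdorff manifold, $\iota$ a smooth immersion) that is Lagrangian, i.e. $\dim_{\mathbb R}L=\dim_{\mathbb C}M$ and $\iota^*\omega=0$, and totally geodesic, i.e. its second fundamental form vanishes identically; identify $L$ with its image $\iota(L)$. Let $\mathbb D\subset\mathbb C$ be the open unit disc. Then there is no nonconstant map $u\colon\overline{\mathbb D}\to M$ that is smooth on the closed disc $\overline{\mathbb D}$, holomorphic on $\mathbb D$, and satisfies $u(\partial\mathbb D)\subseteq L$. -/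

import Mathlib

open scoped Manifold ContDiff

noncomputable section

namespace KahlerDisc

section Manifold

variable {E : Type*} [NormedAddCommGroup E] [NormedSpace ℂ E]
  {M : Type*} [TopologicalSpace M] [ChartedSpace E M]

/-- A complex manifold (holomorphic transition maps) is a smooth real manifold. -/
instance realIsManifold [h : IsManifold 𝓘(ℂ, E) ω M] : IsManifold 𝓘(ℝ, E) ∞ M := by
  refine isManifold_of_contDiffOn 𝓘(ℝ, E) ∞ M fun e e' he he' => ?_
  have h1 := contDiffGroupoid_le (n := ω) (m := ∞) (I := 𝓘(ℂ, E)) le_top (h.compatible he he')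
  have h2 := (contDiffGroupoid ∞ 𝓘(ℂ, E)).mem_of_eqOnSource h1 (Setoid.refl _)
  rw [contDiffGroupoid, mem_groupoid_of_pregroupoid] at h2
  exact (show ContDiffOn ℂ ∞ _ _ from h2.1).restrict_scalars ℝ

/-- The complex structure `J` of a complex manifold, acting on real tangent vectors. The tangent
space at `p` is read in the (holomorphic) preferred chart at `p`, where `J` is multiplication
by `i`. -/
def J (p : M) : TangentSpace 𝓘(ℝ, E) p →L[ℝ] TangentSpace 𝓘(ℝ, E) p :=
  (Complex.I • ContinuousLinearMap.id ℝ E : E →L[ℝ] E)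

variable (E M) in
/-- Smooth Riemannian metrics on the real manifold underlying a complex manifold. -/
abbrev Metric [IsManifold 𝓘(ℂ, E) ω M] : Type _ :=
  Bundle.ContMDiffRiemannianMetric 𝓘(ℝ, E) ∞ E (fun p : M => TangentSpace 𝓘(ℝ, E) p)

/-- The point of `M` with coordinate `y` in the preferred chart at `p`. -/
abbrev pointAt (p : M) (y : E) : M := (extChartAt 𝓘(ℝ, E) p).symm y

/-- The coordinate frame at `y` of the preferred chart at `p`: the differential at `y` of the
inverse of this chart. -/
def frame (p : M) (y : E) : E →L[ℝ] TangentSpace 𝓘(ℝ, E) (pointAt p y) :=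
  mfderiv 𝓘(ℝ, E) 𝓘(ℝ, E) (extChartAt 𝓘(ℝ, E) p).symm y

variable [IsManifold 𝓘(ℂ, E) ω M] (g : Metric E M)

/-- The fundamental two-form `ω(v, w) = g(J v, w)`; if `g` is `J`-invariant, this is the form
with `g(v, w) = ω(v, J w)`. -/
def fundamentalForm (q : M) (v w : TangentSpace 𝓘(ℝ, E) q) : ℝ := g.inner q (J q v) w

/-- The coordinate expression of the two-form `ω` in the preferred chart at `p`. -/
def formInChart (p : M) (y v w : E) : ℝ :=
  fundamentalForm g (pointAt p y) (frame p y v) (frame p y w)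

/-- `g` is a Kähler metric: it is `J`-invariant and the two-form `ω` is closed, `dω = 0`
(written out in the charts, on triples of constant vector fields). -/
structure IsKahler : Prop where
  hermitian : ∀ (q : M) (v w : TangentSpace 𝓘(ℝ, E) q), g.inner q (J q v) (J q w) = g.inner q v w
  closed : ∀ (p : M), ∀ y ∈ (extChartAt 𝓘(ℝ, E) p).target, ∀ a b c : E,
    fderiv ℝ (fun z => formInChart g p z b c) y a + fderiv ℝ (fun z => formInChart g p z c a) y b
      + fderiv ℝ (fun z => formInChart g p z a b) y c = 0

/-- The coordinate expression of the metric in the preferred chart at `p`. -/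
def metricInChart (p : M) (y : E) : E →L[ℝ] E →L[ℝ] ℝ :=
  let B : E →L[ℝ] E →L[ℝ] ℝ := g.inner (pointAt p y)
  B.bilinearComp (frame p y) (frame p y)

/-- The Christoffel symbols of the first kind in the preferred chart at `p`, as the linear form
`z ↦ (∂_v g(w, z) + ∂_w g(v, z) - ∂_z g(v, w)) / 2`. -/
def christoffelFirst (p : M) (y v w : E) : E →L[ℝ] ℝ :=
  (1 / 2 : ℝ) • (fderiv ℝ (metricInChart g p) y v w + fderiv ℝ (metricInChart g p) y w v
    - ((fderiv ℝ (metricInChart g p) y).flip v).flip w)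

/-- The Christoffel symbols `Γ(v, w)` of the Levi-Civita connection in the preferred chart at `p`:
the vector that represents `christoffelFirst` with respect to the metric. Thus
`∇_v W = D_v W + Γ(v, W)` in this chart. -/
def christoffel (p : M) (y v w : E) : E :=
  (metricInChart g p y).inverse (christoffelFirst g p y v w)

/-- The Riemann curvature `R(v, w)z = ∇_v ∇_w z - ∇_w ∇_v z - ∇_[v, w] z` at `p`, computed on
constant vector fields in the preferred chart at `p`. -/
def curvature (p : M) (v w z : TangentSpace 𝓘(ℝ, E) p) : TangentSpace 𝓘(ℝ, E) p :=
  let Γ : E → E → E → E := christoffel g p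
  let x : E := extChartAt 𝓘(ℝ, E) p p
  let R : E → E → E → E := fun a b c =>
    fderiv ℝ (fun y => Γ y b c) x a - fderiv ℝ (fun y => Γ y a c) x b
      + Γ x a (Γ x b c) - Γ x b (Γ x a c)
  R v w z

/-- The sectional curvature of the real plane in `T_p M` spanned by `v` and `w` (meaningful for
linearly independent `v` and `w`). -/
def sectionalCurvature (p : M) (v w : TangentSpace 𝓘(ℝ, E) p) : ℝ :=
  g.inner p (curvature g p v w w) v / (g.inner p v v * g.inner p w w - g.inner p v w ^ 2)

/-- All sectional curvatures are nonpositive. -/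
def NonposSectionalCurvature : Prop :=
  ∀ (p : M) (v w : TangentSpace 𝓘(ℝ, E) p), LinearIndependent ℝ ![v, w] →
    sectionalCurvature g p v w ≤ 0

section Submanifold

variable {F : Type*} [NormedAddCommGroup F] [NormedSpace ℝ F]
  {L : Type*} [TopologicalSpace L] [ChartedSpace F L] (ι : L → M)

variable (F) in
/-- The immersed submanifold `ι : L → M` is Lagrangian: `ι` is a smooth immersion, the real
dimension of `L` is the complex dimension of `M`, and `ι^* ω = 0`. -/
structure IsLagrangian : Prop where
  immersion : Manifold.IsImmersion 𝓘(ℝ, F) 𝓘(ℝ, E) ∞ ι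
  dim : Module.finrank ℝ F = Module.finrank ℂ E
  isotropic : ∀ (q : L) (a b : TangentSpace 𝓘(ℝ, F) q),
    fundamentalForm g (ι q) (mfderiv 𝓘(ℝ, F) 𝓘(ℝ, E) ι q a) (mfderiv 𝓘(ℝ, F) 𝓘(ℝ, E) ι q b) = 0

/-- The ambient covariant derivative `∇_a (dι b)` at `q`, for `a` and `b` constant vector fields in
the preferred chart of `L` at `q`; that is `D²f(a, b) + Γ(Df a, Df b)`, where `f` is the expression
of `ι` in the preferred charts at `q` and `ι q`. -/
def ambientDerivative (q : L) (a b : F) : TangentSpace 𝓘(ℝ, E) (ι q) :=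
  let f : F → E := extChartAt 𝓘(ℝ, E) (ι q) ∘ ι ∘ (extChartAt 𝓘(ℝ, F) q).symm
  let x : F := extChartAt 𝓘(ℝ, F) q q
  let r : E := fderiv ℝ (fderiv ℝ f) x a b
    + christoffel g (ι q) (extChartAt 𝓘(ℝ, E) (ι q) (ι q)) (fderiv ℝ f x a) (fderiv ℝ f x b)
  r

variable (F) in
/-- The immersed submanifold `ι : L → M` is totally geodesic: its second fundamental form, i.e. the
component of `∇_a (dι b)` normal to `L`, vanishes identically. -/
def IsTotallyGeodesic : Prop :=
  ∀ (q : L) (a b : F) (ν : TangentSpace 𝓘(ℝ, E) (ι q)),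
    (∀ c : TangentSpace 𝓘(ℝ, F) q, g.inner (ι q) (mfderiv 𝓘(ℝ, F) 𝓘(ℝ, E) ι q c) ν = 0) →
    g.inner (ι q) (ambientDerivative g ι q a b) ν = 0

end Submanifold

end Manifold

end KahlerDisc

end

/-! Let `X` be the velocity of `u` along the rotations of the disc and `f = |X|²` (`rotEnergy`). The
theorem follows from `f = 0`, which the maximum principle gives from three facts.

Subharmonicity. Put `V = u ∘ exp` on the left half plane, so that `X = J V'` and `f ∘ exp = |V'|²`.
On a Kähler manifold `J` is parallel, so the two second derivatives of `|V'|²`, along `1` and `i`,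
add up to `4|∇V'|² - 2 g(R(V', JV')JV', V')`. This is nonnegative because only the holomorphic
sectional curvature enters (`exists_rotEnergy_second_derivs`).

Neumann condition. Holomorphy turns the radial derivative of `f` into `2 g(∇_X X, J X)`
(`radial_deriv_rotEnergy_boundary`). On the boundary `X` is tangent to `L`; `L` is totally geodesic,
so `∇_X X` is tangent too, and `J X` is normal because `L` is Lagrangian. The product vanishes. This
argument needs a smooth lift of the boundary curve to `L`, which may fail to exist at some points
when `ι` is merely an immersion. By Baire's theorem local lifts exist near a dense set of angles
(`dense_liftsAt`), and continuity of the radial derivative does the rest (`radial_deriv_eq_zero`).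

Value at the centre. `f 0 = 0`, since the rotation field vanishes there. A positive maximum of `f`
would, by a Hopf barrier argument on an annulus, lie on the circle and have nonzero radial
derivative (`nonpos_of_neumann`).

Hence `V' = 0`, and `u` is constant on the punctured open disc, then on the closed disc by
continuity. -/

noncomputable section

namespace KahlerDisc

/-! ### Local Kähler geometry and the Bochner-type formula. -/

section Model

variable {E : Type*} [NormedAddCommGroup E] [NormedSpace ℂ E]

/-- A Kähler metric `G` on an open subset `Ω` of a complex vector space, with its Levi-Civita
connection `D + Γ`, for which multiplication by `i` is parallel. -/
structure IsKahlerModel (Ω : Set E) (G : E → E →L[ℝ] E →L[ℝ] ℝ)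
    (Γ : E → E →L[ℝ] E →L[ℝ] E) : Prop where
  isOpen : IsOpen Ω
  contDiffOn_metric : ContDiffOn ℝ ∞ G Ω
  contDiffOn_connection : ContDiffOn ℝ ∞ Γ Ω
  symm : ∀ y ∈ Ω, ∀ a b, G y a b = G y b a
  nonneg : ∀ y ∈ Ω, ∀ a, 0 ≤ G y a a
  hermitian : ∀ y ∈ Ω, ∀ a b, G y (Complex.I • a) (Complex.I • b) = G y a b
  compat : ∀ y ∈ Ω, ∀ a b c,
    fderiv ℝ G y a b c = G y (Γ y a b) c + G y b (Γ y a c)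
  torsionFree : ∀ y ∈ Ω, ∀ a b, Γ y a b = Γ y b a
  map_I_smul : ∀ y ∈ Ω, ∀ a b, Γ y a (Complex.I • b) = Complex.I • Γ y a b

/-- The curvature `R(a, b)c` at `y` of the connection `D + Γ`. -/
def modelCurvature (Γ : E → E →L[ℝ] E →L[ℝ] E) (y a b c : E) : E :=
  fderiv ℝ Γ y a b c - fderiv ℝ Γ y b a c + Γ y a (Γ y b c) - Γ y b (Γ y a c)

/-- The covariant derivative `∇_W W`, where `W` is the complex velocity of `V`. -/
def covAccel (Γ : E → E →L[ℝ] E →L[ℝ] E) (V : ℂ → E) (ζ : ℂ) : E :=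
  deriv (deriv V) ζ + Γ (V ζ) (deriv V ζ) (deriv V ζ)

namespace IsKahlerModel

variable {Ω : Set E} {G : E → E →L[ℝ] E →L[ℝ] ℝ} {Γ : E → E →L[ℝ] E →L[ℝ] E}

theorem smul_right (h : IsKahlerModel Ω G Γ) {y : E} (hy : y ∈ Ω) (τ : ℂ) (a b : E) :
    Γ y a (τ • b) = τ • Γ y a b := by
  have e : ∀ v : E, τ • v = τ.re • v + τ.im • Complex.I • v := fun v => by
    conv_lhs => rw [← Complex.re_add_im τ]
    rw [add_smul, mul_smul]; rfl
  rw [e, e, map_add, map_smul, map_smul, h.map_I_smul y hy]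

theorem smul_left (h : IsKahlerModel Ω G Γ) {y : E} (hy : y ∈ Ω) (τ : ℂ) (a b : E) :
    Γ y (τ • a) b = τ • Γ y a b := by
  rw [h.torsionFree y hy, h.smul_right hy, h.torsionFree y hy]

theorem hasFDerivAt_metric (h : IsKahlerModel Ω G Γ) {y : E} (hy : y ∈ Ω) :
    HasFDerivAt G (fderiv ℝ G y) y :=
  ((h.contDiffOn_metric.differentiableOn (by simp)).differentiableAt
    (h.isOpen.mem_nhds hy)).hasFDerivAt

theorem hasFDerivAt_connection (h : IsKahlerModel Ω G Γ) {y : E} (hy : y ∈ Ω) :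
    HasFDerivAt Γ (fderiv ℝ Γ y) y :=
  ((h.contDiffOn_connection.differentiableOn (by simp)).differentiableAt
    (h.isOpen.mem_nhds hy)).hasFDerivAt

/-- The derivative of `Γ(X, Y)` along a curve. -/
theorem hasDerivAt_connection (h : IsKahlerModel Ω G Γ) {y X Y : ℝ → E} {y' X' Y' : E} {t : ℝ}
    (ht : y t ∈ Ω) (hy : HasDerivAt y y' t) (hX : HasDerivAt X X' t) (hY : HasDerivAt Y Y' t) :
    HasDerivAt (fun s => Γ (y s) (X s) (Y s))
      (fderiv ℝ Γ (y t) y' (X t) (Y t) + Γ (y t) X' (Y t) + Γ (y t) (X t) Y') t := by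
  have h1 : HasDerivAt (fun s => Γ (y s)) (fderiv ℝ Γ (y t) y') t :=
    @HasFDerivAt.comp_hasDerivAt ℝ _ E _ _ (E →L[ℝ] E →L[ℝ] E) _ _ y y' t _ _
      (h.hasFDerivAt_connection ht) hy
  simpa using (h1.clm_apply hX).clm_apply hY

/-- Metric compatibility along a curve. -/
theorem hasDerivAt_metric (h : IsKahlerModel Ω G Γ) {y X Y : ℝ → E} {y' X' Y' : E} {t : ℝ}
    (ht : y t ∈ Ω) (hy : HasDerivAt y y' t) (hX : HasDerivAt X X' t) (hY : HasDerivAt Y Y' t) :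
    HasDerivAt (fun s => G (y s) (X s) (Y s))
      (G (y t) (X' + Γ (y t) y' (X t)) (Y t) + G (y t) (X t) (Y' + Γ (y t) y' (Y t))) t := by
  have h1 : HasDerivAt (fun s => G (y s)) (fderiv ℝ G (y t) y') t :=
    @HasFDerivAt.comp_hasDerivAt ℝ _ E _ _ (E →L[ℝ] E →L[ℝ] ℝ) _ _ y y' t _ _
      (h.hasFDerivAt_metric ht) hy
  have h2 := (h1.clm_apply hX).clm_apply hY
  refine h2.congr_deriv ?_
  simp only [add_apply, h.compat _ ht, map_add]
  ring

section Disc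

variable {V : ℂ → E} {O : Set ℂ}

theorem hasDerivAt_line (hO : IsOpen O) (hV : DifferentiableOn ℂ V O) (ζ τ : ℂ) (t : ℝ)
    (ht : ζ + t * τ ∈ O) :
    HasDerivAt (fun s : ℝ => V (ζ + s * τ)) (τ • deriv V (ζ + t * τ)) t := by
  have h1 : HasDerivAt (fun s : ℝ => ζ + s * τ) τ t := by
    simpa using ((Complex.ofRealCLM.hasDerivAt (x := t)).mul_const τ).const_add ζ
  exact HasDerivAt.scomp t ((hV.differentiableAt (hO.mem_nhds ht)).hasDerivAt) h1

/-- The first derivative of the energy density of a holomorphic map. -/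
theorem hasDerivAt_energy [CompleteSpace E] (h : IsKahlerModel Ω G Γ) (hO : IsOpen O) (hV : DifferentiableOn ℂ V O)
    (hm : Set.MapsTo V O Ω) (ζ τ : ℂ) (t : ℝ) (ht : ζ + t * τ ∈ O) :
    HasDerivAt (fun s : ℝ => G (V (ζ + s * τ)) (deriv V (ζ + s * τ)) (deriv V (ζ + s * τ)))
      (2 * G (V (ζ + t * τ)) (τ • covAccel Γ V (ζ + t * τ)) (deriv V (ζ + t * τ))) t := by
  have h0 := hasDerivAt_line hO hV ζ τ t ht
  have h1 := hasDerivAt_line hO (hV.deriv hO) ζ τ t ht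
  have h2 := h.hasDerivAt_metric (y := fun s : ℝ => V (ζ + s * τ)) (hm ht) h0 h1 h1
  refine h2.congr_deriv ?_
  -- Complex bilinearity of `Γ` pulls the direction `τ` out of the covariant derivative: `∇_{τV'} V'
  -- = τ ∇_{V'} V'`.
  rw [h.smul_left (hm ht), ← smul_add, h.symm _ (hm ht) (deriv V _), two_mul]
  rfl

/-- The second derivative of the energy density of a holomorphic map. -/
theorem hasDerivAt_deriv_energy [CompleteSpace E] (h : IsKahlerModel Ω G Γ) (hO : IsOpen O)
    (hV : DifferentiableOn ℂ V O) (hm : Set.MapsTo V O Ω) (ζ τ : ℂ) (hζ : ζ ∈ O) :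
    HasDerivAt (fun s : ℝ =>
        2 * G (V (ζ + s * τ)) (τ • covAccel Γ V (ζ + s * τ)) (deriv V (ζ + s * τ)))
      (2 * (G (V ζ) ((τ * τ) • (deriv (deriv (deriv V)) ζ
          + (2 : ℝ) • Γ (V ζ) (deriv (deriv V) ζ) (deriv V ζ)
          + Γ (V ζ) (deriv V ζ) (covAccel Γ V ζ))
          + τ • fderiv ℝ Γ (V ζ) (τ • deriv V ζ) (deriv V ζ) (deriv V ζ)) (deriv V ζ)
        + G (V ζ) (τ • covAccel Γ V ζ) (τ • covAccel Γ V ζ))) 0 := by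
  have e : ζ + ((0 : ℝ) : ℂ) * τ = ζ := by simp
  have ht : ζ + ((0 : ℝ) : ℂ) * τ ∈ O := by rwa [e]
  have h0 := hasDerivAt_line hO hV ζ τ 0 ht
  have h1 := hasDerivAt_line hO (hV.deriv hO) ζ τ 0 ht
  have h2 := hasDerivAt_line hO ((hV.deriv hO).deriv hO) ζ τ 0 ht
  have h3 := h.hasDerivAt_connection (y := fun s : ℝ => V (ζ + s * τ)) (hm ht) h0 h1 h1
  have h4 : HasDerivAt (fun s : ℝ => τ • covAccel Γ V (ζ + s * τ)) _ 0 := (h2.add h3).const_smul τ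
  have h5 := (h.hasDerivAt_metric (y := fun s : ℝ => V (ζ + s * τ)) (hm ht) h0 h4 h1).const_mul 2
  refine h5.congr_deriv ?_
  have hv := hm hζ
  simp only [e]
  congr 2
  · congr 2
    simp only [covAccel, h.smul_left hv, h.smul_right hv, smul_add, map_add,
      mul_smul, two_smul, h.torsionFree _ hv (deriv V ζ) (deriv (deriv V) ζ)]
    abel
  · simp only [covAccel, h.smul_left hv, smul_add]

/-- Since `Γ` is complex bilinear in its two vector arguments, its derivative in any real direction
is too. In `R(w, iw)iw` the two terms quadratic in `Γ` then cancel, leaving exactly the combination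
of derivatives of `Γ` that appears in the Laplacian of the energy density. -/
theorem curvature_I_smul (h : IsKahlerModel Ω G Γ) {y : E} (hy : y ∈ Ω) (w : E) :
    modelCurvature Γ y w (Complex.I • w) (Complex.I • w)
      = -(fderiv ℝ Γ y w w w + Complex.I • fderiv ℝ Γ y (Complex.I • w) w w) := by
  have hd : ∀ a b c, HasDerivAt (fun t : ℝ => Γ (y + t • a) b c) (fderiv ℝ Γ y a b c) 0 := by
    intro a b c
    have h1 : HasDerivAt (fun t : ℝ => y + t • a) a 0 := by
      simpa using ((hasDerivAt_id (0 : ℝ)).smul_const a).const_add y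
    have h2 := h.hasDerivAt_connection (by simpa using hy) h1 (hasDerivAt_const _ b)
      (hasDerivAt_const _ c)
    simpa using h2
  have hev : ∀ a : E, ∀ᶠ t : ℝ in nhds 0, y + t • a ∈ Ω := by
    intro a
    have : ContinuousAt (fun t : ℝ => y + t • a) 0 := by fun_prop
    exact this.eventually_mem (h.isOpen.mem_nhds (by simpa using hy))
  have hr : ∀ a b c, fderiv ℝ Γ y a b (Complex.I • c) = Complex.I • fderiv ℝ Γ y a b c := by
    intro a b c
    refine (hd a b (Complex.I • c)).unique (((hd a b c).const_smul Complex.I).congr_of_eventuallyEq ?_)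
    filter_upwards [hev a] with t ht using h.map_I_smul _ ht b c
  have hl : ∀ a b c, fderiv ℝ Γ y a (Complex.I • b) c = Complex.I • fderiv ℝ Γ y a b c := by
    intro a b c
    refine (hd a (Complex.I • b) c).unique (((hd a b c).const_smul Complex.I).congr_of_eventuallyEq ?_)
    filter_upwards [hev a] with t ht using h.smul_left ht _ b c
  rw [modelCurvature]
  simp only [hr, hl, h.smul_left hy, h.smul_right hy, smul_smul, Complex.I_mul_I]
  simp only [neg_smul, one_smul]
  abel

/-- The energy density of a holomorphic map into a model of nonpositive holomorphic sectional
curvature is subharmonic. -/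
theorem exists_second_derivs [CompleteSpace E] (h : IsKahlerModel Ω G Γ) (hO : IsOpen O)
    (hV : DifferentiableOn ℂ V O) (hm : Set.MapsTo V O Ω) {ζ : ℂ} (hζ : ζ ∈ O)
    (hK : G (V ζ) (modelCurvature Γ (V ζ) (deriv V ζ) (Complex.I • deriv V ζ)
      (Complex.I • deriv V ζ)) (deriv V ζ) ≤ 0) :
    ∃ d₁ d₂ : ℝ, 0 ≤ d₁ + d₂ ∧
      HasDerivAt (fun s : ℝ =>
        2 * G (V (ζ + s * 1)) ((1 : ℂ) • covAccel Γ V (ζ + s * 1)) (deriv V (ζ + s * 1))) d₁ 0 ∧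
      HasDerivAt (fun s : ℝ => 2 * G (V (ζ + s * Complex.I))
        (Complex.I • covAccel Γ V (ζ + s * Complex.I)) (deriv V (ζ + s * Complex.I))) d₂ 0 := by
  refine ⟨_, _, ?_, h.hasDerivAt_deriv_energy hO hV hm ζ 1 hζ,
    h.hasDerivAt_deriv_energy hO hV hm ζ Complex.I hζ⟩
  have hv := hm hζ
  rw [h.curvature_I_smul hv] at hK
  have hB := h.nonneg _ hv (covAccel Γ V ζ)
  -- The terms multiplied by `τ * τ` cancel between `τ = 1` and `τ = i`. What remains is `4|∇V'|²`
  -- minus twice the curvature term bounded in `hK`.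
  rw [h.hermitian _ hv, Complex.I_mul_I]
  simp only [one_mul, one_smul, neg_smul, map_add, map_neg, add_apply,
    neg_apply] at hK ⊢
  linarith

end Disc

end IsKahlerModel

end Model

/-! ### The metric in holomorphic charts. -/

section Chart

variable {E : Type*} [NormedAddCommGroup E] [NormedSpace ℂ E]
  {M : Type*} [TopologicalSpace M] [ChartedSpace E M]

theorem isOpen_chart_target (p : M) : IsOpen (extChartAt 𝓘(ℝ, E) p).target :=
  isOpen_extChartAt_target p

/-- The coordinate frame, read in the preferred chart at the base point. -/
def coordFrame (p : M) (y : E) : E →L[ℝ] E :=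
  fderiv ℝ (extChartAt 𝓘(ℝ, E) (pointAt p y) ∘ (extChartAt 𝓘(ℝ, E) p).symm) y

variable [IsManifold 𝓘(ℂ, E) ω M]

instance realIsManifoldOne : IsManifold 𝓘(ℝ, E) 1 M :=
  IsManifold.of_le (n := ∞) (by simp)

theorem contMDiffOn_pointAt (p : M) :
    ContMDiffOn 𝓘(ℝ, E) 𝓘(ℝ, E) ∞ (extChartAt 𝓘(ℝ, E) p).symm (extChartAt 𝓘(ℝ, E) p).target :=
  contMDiffOn_extChartAt_symm p

theorem mdifferentiableAt_pointAt (p : M) {y : E} (hy : y ∈ (extChartAt 𝓘(ℝ, E) p).target) :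
    MDifferentiableAt 𝓘(ℝ, E) 𝓘(ℝ, E) (extChartAt 𝓘(ℝ, E) p).symm y :=
  ((contMDiffOn_pointAt p).contMDiffAt ((isOpen_chart_target p).mem_nhds hy)).mdifferentiableAt
    (by simp)

theorem frame_eq (p : M) {y : E} (hy : y ∈ (extChartAt 𝓘(ℝ, E) p).target) :
    frame p y = coordFrame p y := by
  have h := mdifferentiableAt_pointAt p hy
  have h2 : frame p y = fderivWithin ℝ (extChartAt 𝓘(ℝ, E) (pointAt p y)
      ∘ (extChartAt 𝓘(ℝ, E) p).symm) Set.univ y := by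
    have := h.mfderiv
    simp only [writtenInExtChartAt, extChartAt_model_space_eq_id, modelWithCornersSelf_coe,
      Set.range_id, PartialEquiv.refl_symm, PartialEquiv.refl_coe, Function.comp_id, id] at this
    exact this
  rw [h2, fderivWithin_univ]
  rfl

theorem differentiableAt_chart_change (p q : M) {y : E}
    (hy : y ∈ (extChartAt 𝓘(ℝ, E) p).target)
    (hq : pointAt p y ∈ (chartAt E q).source) :
    DifferentiableAt ℂ (extChartAt 𝓘(ℝ, E) q ∘ (extChartAt 𝓘(ℝ, E) p).symm) y := by
  have h := contDiffWithinAt_ext_coord_change (I := 𝓘(ℂ, E)) (n := ω) q p (y := y)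
    ⟨hy, by rw [Set.mem_preimage, extChartAt_source]; exact hq⟩
  simp only [modelWithCornersSelf_coe, Set.range_id] at h
  exact (contDiffWithinAt_univ.1 h).differentiableAt (by simp)

/-- Chart changes are holomorphic, so their real differentials commute with `i`. Hence `J` is
multiplication by `i` in every chart, not only at its base point. -/
theorem coordFrame_smul (p : M) {y : E} (hy : y ∈ (extChartAt 𝓘(ℝ, E) p).target) (v : E) :
    coordFrame p y (Complex.I • v) = Complex.I • coordFrame p y v := by
  have h := differentiableAt_chart_change p (pointAt p y) hy (mem_chart_source E _)
  rw [coordFrame, h.fderiv_restrictScalars ℝ]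
  exact map_smul (fderiv ℂ _ y) Complex.I v

omit [IsManifold 𝓘(ℂ, E) ω M] in
theorem coordFrame_center (p : M) (v : E) : coordFrame p (extChartAt 𝓘(ℝ, E) p p) v = v := by
  have h : (extChartAt 𝓘(ℝ, E) (pointAt p (extChartAt 𝓘(ℝ, E) p p))
      ∘ (extChartAt 𝓘(ℝ, E) p).symm) =ᶠ[nhds (extChartAt 𝓘(ℝ, E) p p)] id := by
    filter_upwards [(isOpen_chart_target p).mem_nhds (mem_extChartAt_target p)] with z hz
    rw [pointAt, extChartAt_to_inv]
    exact (extChartAt 𝓘(ℝ, E) p).right_inv hz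
  rw [coordFrame, h.fderiv_eq, fderiv_id]
  rfl

theorem coordFrame_injective (p : M) {y : E} (hy : y ∈ (extChartAt 𝓘(ℝ, E) p).target) :
    Function.Injective (coordFrame p y) := by
  have h := isInvertible_mfderivWithin_extChartAt_symm (I := 𝓘(ℝ, E)) hy
  simp only [modelWithCornersSelf_coe, Set.range_id, mfderivWithin_univ] at h
  have h2 := h.injective
  have h3 := frame_eq p hy
  unfold frame at h3
  rw [h3] at h2
  exact h2

variable (g : Metric E M)

/-- The metric at `q`, read in the preferred chart at `q`. -/
def innerAt (q : M) : E →L[ℝ] E →L[ℝ] ℝ := g.inner q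

theorem innerAt_symm (q : M) (v w : E) : innerAt g q v w = innerAt g q w v := g.symm q v w

theorem innerAt_pos (q : M) {v : E} (hv : v ≠ 0) : 0 < innerAt g q v v := g.pos q v hv

theorem metricInChart_apply (p : M) {y : E} (hy : y ∈ (extChartAt 𝓘(ℝ, E) p).target) (v w : E) :
    metricInChart g p y v w
      = innerAt g (pointAt p y) (coordFrame p y v) (coordFrame p y w) := by
  rw [← frame_eq p hy]
  rfl

theorem metricInChart_center (p : M) (v w : E) :
    metricInChart g p (extChartAt 𝓘(ℝ, E) p p) v w = innerAt g p v w := by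
  rw [metricInChart_apply g p (mem_extChartAt_target p), coordFrame_center, coordFrame_center,
    pointAt, extChartAt_to_inv]

theorem metricInChart_symm (p : M) {y : E} (hy : y ∈ (extChartAt 𝓘(ℝ, E) p).target) (v w : E) :
    metricInChart g p y v w = metricInChart g p y w v := by
  rw [metricInChart_apply g p hy, innerAt_symm, metricInChart_apply g p hy]

theorem metricInChart_pos (p : M) {y : E} (hy : y ∈ (extChartAt 𝓘(ℝ, E) p).target) {v : E}
    (hv : v ≠ 0) : 0 < metricInChart g p y v v := by
  rw [metricInChart_apply g p hy]
  exact innerAt_pos g _ fun h => hv (coordFrame_injective p hy (h.trans (map_zero _).symm))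

theorem formInChart_eq (p : M) {y : E} (hy : y ∈ (extChartAt 𝓘(ℝ, E) p).target) (v w : E) :
    formInChart g p y v w = metricInChart g p y (Complex.I • v) w := by
  rw [metricInChart_apply g p hy, coordFrame_smul p hy, ← frame_eq p hy]
  rfl

variable {g} in
theorem IsKahler.innerAt_I_smul (hg : IsKahler g) (q : M) (v w : E) :
    innerAt g q (Complex.I • v) (Complex.I • w) = innerAt g q v w := hg.hermitian q v w

variable {g} in
theorem IsKahler.metricInChart_I_smul (hg : IsKahler g) (p : M) {y : E}
    (hy : y ∈ (extChartAt 𝓘(ℝ, E) p).target) (v w : E) :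
    metricInChart g p y (Complex.I • v) (Complex.I • w) = metricInChart g p y v w := by
  rw [metricInChart_apply g p hy, coordFrame_smul p hy, coordFrame_smul p hy, hg.innerAt_I_smul,
    metricInChart_apply g p hy]

/-- The frame field is the tangent map of the inverse chart applied to a constant section, which is
how smoothness of `g` passes to its coefficients. -/
theorem contMDiffOn_frame (p : M) (v : E) :
    ContMDiffOn 𝓘(ℝ, E) (𝓘(ℝ, E).prod 𝓘(ℝ, E)) ∞
      (fun y => Bundle.TotalSpace.mk' E (E := fun q : M => TangentSpace 𝓘(ℝ, E) q)
        (pointAt p y) (frame p y v)) (extChartAt 𝓘(ℝ, E) p).target := by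
  have h1 := (contMDiffOn_pointAt (E := E) p).contMDiffOn_tangentMapWithin (m := ∞) (by simp)
    (isOpen_chart_target p).uniqueMDiffOn
  have h2 : ContMDiff 𝓘(ℝ, E) 𝓘(ℝ, E).tangent ∞
      (fun y : E => (⟨y, v⟩ : TangentBundle 𝓘(ℝ, E) E)) :=
    contMDiff_vectorSpace_iff_contDiff.2 contDiff_const
  refine (ContMDiffOn.comp h1 (h2.contMDiffOn (s := (extChartAt 𝓘(ℝ, E) p).target))
    fun y hy => hy).congr ?_
  intro y hy
  simp only [Function.comp_apply, tangentMapWithin]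
  rw [mfderivWithin_of_isOpen (isOpen_chart_target p) hy]
  rfl

theorem contDiffOn_metricInChart [FiniteDimensional ℂ E] (p : M) :
    ContDiffOn ℝ ∞ (metricInChart g p) (extChartAt 𝓘(ℝ, E) p).target := by
  have : FiniteDimensional ℝ E := FiniteDimensional.complexToReal E
  rw [contDiffOn_clm_apply]
  intro v
  rw [contDiffOn_clm_apply]
  intro w
  rw [← contMDiffOn_iff_contDiffOn]
  intro y hy
  have : ContMDiffWithinAt 𝓘(ℝ, E) (𝓘(ℝ, E).prod 𝓘(ℝ)) ∞
      (fun y ↦ Bundle.TotalSpace.mk' ℝ (E := Bundle.Trivial M ℝ) (pointAt p y)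
        (g.inner (pointAt p y) (frame p y v) (frame p y w))) (extChartAt 𝓘(ℝ, E) p).target y := by
    apply ContMDiffWithinAt.clm_bundle_apply₂ (F₁ := E) (F₂ := E)
    · exact ContMDiffAt.comp_contMDiffWithinAt y g.contMDiff.contMDiffAt (contMDiffOn_pointAt p y hy)
    · exact contMDiffOn_frame p v y hy
    · exact contMDiffOn_frame p w y hy
  simp only [Bundle.contMDiffWithinAt_totalSpace] at this
  exact this.2

end Chart

/-! ### The Levi-Civita connection and parallelism of the complex structure. -/

section Connection

variable {E : Type*} [NormedAddCommGroup E] [NormedSpace ℂ E]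
  {M : Type*} [TopologicalSpace M] [ChartedSpace E M] [IsManifold 𝓘(ℂ, E) ω M] (g : Metric E M)

theorem christoffelFirst_apply (p : M) (y v w z : E) :
    christoffelFirst g p y v w z = (1 / 2 : ℝ) * (fderiv ℝ (metricInChart g p) y v w z
      + fderiv ℝ (metricInChart g p) y w v z - fderiv ℝ (metricInChart g p) y z v w) := rfl

/-- The Christoffel symbols as a bilinear map. -/
def christoffelLinear (p : M) (y : E) : E →ₗ[ℝ] E →ₗ[ℝ] E :=
  LinearMap.mk₂ ℝ (christoffel g p y)
    (fun a b c => by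
      rw [christoffel, christoffel, christoffel, ← map_add]
      congr 1; ext z
      simp only [christoffelFirst_apply, map_add, add_apply]; ring)
    (fun r a b => by
      rw [christoffel, christoffel, ← map_smul]
      congr 1; ext z
      simp only [christoffelFirst_apply, map_smul, smul_apply, smul_eq_mul]; ring)
    (fun a b c => by
      rw [christoffel, christoffel, christoffel, ← map_add]
      congr 1; ext z
      simp only [christoffelFirst_apply, map_add, add_apply]; ring)
    (fun r a b => by
      rw [christoffel, christoffel, ← map_smul]
      congr 1; ext z
      simp only [christoffelFirst_apply, map_smul, smul_apply, smul_eq_mul]; ring)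

variable [FiniteDimensional ℂ E]

instance finiteDimensionalReal : FiniteDimensional ℝ E := FiniteDimensional.complexToReal E

/-- The Christoffel symbols as a continuous bilinear map. -/
def connection (p : M) (y : E) : E →L[ℝ] E →L[ℝ] E :=
  (christoffelLinear g p y).toContinuousBilinearMap

theorem connection_apply (p : M) (y v w : E) : connection g p y v w = christoffel g p y v w := rfl

/-- Positive definiteness gives injectivity, and equality of dimensions does the rest. It makes
`inverse` in the definition of `christoffel` a true inverse rather than its default value. -/
theorem isInvertible_metricInChart (p : M) {y : E} (hy : y ∈ (extChartAt 𝓘(ℝ, E) p).target) :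
    (metricInChart g p y).IsInvertible := by
  have hi : Function.Injective (metricInChart g p y) := by
    rw [injective_iff_map_eq_zero]
    intro v hv
    by_contra h
    have := metricInChart_pos g p hy h
    rw [hv] at this
    simp at this
  let e₀ : (E →ₗ[ℝ] ℝ) ≃ₗ[ℝ] (E →L[ℝ] ℝ) := LinearMap.toContinuousLinearMap
  have hd : Module.finrank ℝ E = Module.finrank ℝ (E →L[ℝ] ℝ) := by
    rw [← e₀.finrank_eq]
    exact Subspace.dual_finrank_eq.symm
  have : FiniteDimensional ℝ (E →L[ℝ] ℝ) := e₀.finiteDimensional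
  let e := LinearEquiv.ofInjectiveOfFinrankEq (metricInChart g p y : E →ₗ[ℝ] E →L[ℝ] ℝ) hi hd
  exact ⟨e.toContinuousLinearEquiv, by ext; rfl⟩

theorem metricInChart_connection (p : M) {y : E} (hy : y ∈ (extChartAt 𝓘(ℝ, E) p).target)
    (v w z : E) :
    metricInChart g p y (connection g p y v w) z
      = (1 / 2 : ℝ) * (fderiv ℝ (metricInChart g p) y v w z
      + fderiv ℝ (metricInChart g p) y w v z - fderiv ℝ (metricInChart g p) y z v w) := by
  rw [connection_apply, christoffel, (isInvertible_metricInChart g p hy).self_apply_inverse,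
    christoffelFirst_apply]

theorem eq_of_metricInChart (p : M) {y : E} (hy : y ∈ (extChartAt 𝓘(ℝ, E) p).target)
    {a b : E} (h : ∀ z, metricInChart g p y a z = metricInChart g p y b z) : a = b :=
  (isInvertible_metricInChart g p hy).injective (ContinuousLinearMap.ext h)

theorem hasFDerivAt_metricInChart_apply (p : M) {y : E}
    (hy : y ∈ (extChartAt 𝓘(ℝ, E) p).target) (b c : E) :
    HasFDerivAt (fun z => metricInChart g p z b c)
      (((fderiv ℝ (metricInChart g p) y).flip b).flip c) y := by
  have h := (((contDiffOn_metricInChart g p).differentiableOn (by simp)).differentiableAt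
    ((isOpen_chart_target p).mem_nhds hy)).hasFDerivAt
  have h1 := HasFDerivAt.clm_apply (G := E) (H := E →L[ℝ] ℝ) h (hasFDerivAt_const b y)
  refine (HasFDerivAt.clm_apply h1 (hasFDerivAt_const c y)).congr_fderiv ?_
  ext
  simp

theorem fderiv_metricInChart_apply (p : M) {y : E} (hy : y ∈ (extChartAt 𝓘(ℝ, E) p).target)
    (a b c : E) :
    fderiv ℝ (fun z => metricInChart g p z b c) y a = fderiv ℝ (metricInChart g p) y a b c := by
  rw [(hasFDerivAt_metricInChart_apply g p hy b c).fderiv]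
  rfl

theorem contDiffOn_connection (p : M) :
    ContDiffOn ℝ ∞ (connection g p) (extChartAt 𝓘(ℝ, E) p).target := by
  rw [contDiffOn_clm_apply]
  intro v
  rw [contDiffOn_clm_apply]
  intro w
  have h1 : ContDiffOn ℝ ∞ (fun y => christoffelFirst g p y v w)
      (extChartAt 𝓘(ℝ, E) p).target := by
    rw [contDiffOn_clm_apply]
    intro z
    have h : ∀ a b c : E, ContDiffOn ℝ ∞ (fun y => fderiv ℝ (metricInChart g p) y a b c)
        (extChartAt 𝓘(ℝ, E) p).target := fun a b c => by
      have h2 : ContDiffOn ℝ ∞ (fun z => metricInChart g p z b c) (extChartAt 𝓘(ℝ, E) p).target :=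
        ((contDiffOn_metricInChart g p).clm_apply contDiffOn_const).clm_apply contDiffOn_const
      exact ((h2.fderiv_of_isOpen (m := ∞) (isOpen_chart_target p) (by simp)).clm_apply
        (contDiffOn_const (c := a))).congr fun y hy => (fderiv_metricInChart_apply g p hy a b c).symm
    exact contDiffOn_const.mul (((h v w z).add (h w v z)).sub (h z v w))
  have h2 : ContDiffOn ℝ ∞ (fun y => (metricInChart g p y).inverse)
      (extChartAt 𝓘(ℝ, E) p).target := fun y hy =>
    (isInvertible_metricInChart g p hy).contDiffAt_map_inverse.comp_contDiffWithinAt y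
      (contDiffOn_metricInChart g p y hy)
  exact h2.clm_apply h1

theorem fderiv_metricInChart_symm (p : M) {y : E} (hy : y ∈ (extChartAt 𝓘(ℝ, E) p).target)
    (a b c : E) :
    fderiv ℝ (metricInChart g p) y a b c = fderiv ℝ (metricInChart g p) y a c b := by
  rw [← fderiv_metricInChart_apply g p hy, ← fderiv_metricInChart_apply g p hy]
  congr 1
  refine Filter.EventuallyEq.fderiv_eq ?_
  filter_upwards [(isOpen_chart_target p).mem_nhds hy] with z hz using metricInChart_symm g p hz b c

variable {g}

theorem IsKahler.fderiv_metricInChart_I_smul (hg : IsKahler g) (p : M) {y : E}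
    (hy : y ∈ (extChartAt 𝓘(ℝ, E) p).target) (a b c : E) :
    fderiv ℝ (metricInChart g p) y a (Complex.I • b) (Complex.I • c)
      = fderiv ℝ (metricInChart g p) y a b c := by
  rw [← fderiv_metricInChart_apply g p hy, ← fderiv_metricInChart_apply g p hy]
  congr 1
  refine Filter.EventuallyEq.fderiv_eq ?_
  filter_upwards [(isOpen_chart_target p).mem_nhds hy] with z hz using
    hg.metricInChart_I_smul p hz b c

theorem IsKahler.fderiv_metricInChart_cyclic (hg : IsKahler g) (p : M) {y : E}
    (hy : y ∈ (extChartAt 𝓘(ℝ, E) p).target) (a b c : E) :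
    fderiv ℝ (metricInChart g p) y a (Complex.I • b) c
      + fderiv ℝ (metricInChart g p) y b (Complex.I • c) a
      + fderiv ℝ (metricInChart g p) y c (Complex.I • a) b = 0 := by
  have h : ∀ a b c : E, fderiv ℝ (fun z => formInChart g p z b c) y a
      = fderiv ℝ (metricInChart g p) y a (Complex.I • b) c := by
    intro a b c
    rw [← fderiv_metricInChart_apply g p hy]
    congr 1
    refine Filter.EventuallyEq.fderiv_eq ?_
    filter_upwards [(isOpen_chart_target p).mem_nhds hy] with z hz using formInChart_eq g p hz b c
  rw [← h, ← h, ← h]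
  exact hg.closed p y hy a b c

/-- The coordinate expression of a Kähler metric in a holomorphic chart. -/
theorem IsKahler.isKahlerModel (hg : IsKahler g) (p : M) :
    IsKahlerModel (extChartAt 𝓘(ℝ, E) p).target (metricInChart g p) (connection g p) where
  isOpen := isOpen_chart_target p
  contDiffOn_metric := contDiffOn_metricInChart g p
  contDiffOn_connection := contDiffOn_connection g p
  symm y hy := metricInChart_symm g p hy
  nonneg y hy a := by
    by_cases h : a = 0
    · simp [h]
    · exact (metricInChart_pos g p hy h).le
  hermitian y hy := hg.metricInChart_I_smul p hy
  compat y hy a b c := by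
    rw [metricInChart_symm g p hy b, metricInChart_connection g p hy,
      metricInChart_connection g p hy, fderiv_metricInChart_symm g p hy a c b,
      fderiv_metricInChart_symm g p hy c a b, fderiv_metricInChart_symm g p hy b a c]
    ring
  torsionFree y hy a b := by
    refine eq_of_metricInChart g p hy fun z => ?_
    rw [metricInChart_connection g p hy, metricInChart_connection g p hy,
      fderiv_metricInChart_symm g p hy z a b]
    ring
  -- This is the classical fact that `dω = 0` implies `∇J = 0`: the difference of the two sides,
  -- paired with `z`, is a combination of closedness at `(ia, b, iz)` and at `(ia, ib, z)`.
  map_I_smul y hy a b := by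
    refine eq_of_metricInChart g p hy fun z => ?_
    have hD := hg.fderiv_metricInChart_cyclic p hy
    have hJ := hg.fderiv_metricInChart_I_smul p hy
    have hs := fderiv_metricInChart_symm g p hy
    have hII : ∀ v : E, Complex.I • Complex.I • v = -v := fun v => by
      rw [smul_smul, Complex.I_mul_I, neg_one_smul]
    have e : ∀ v w : E, metricInChart g p y (Complex.I • v) w
        = -metricInChart g p y v (Complex.I • w) := fun v w => by
      rw [← hg.metricInChart_I_smul p hy (Complex.I • v) w, hII]; simp
    have e' : ∀ v a b : E, fderiv ℝ (metricInChart g p) y v (Complex.I • a) b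
        = -fderiv ℝ (metricInChart g p) y v a (Complex.I • b) := fun v a b => by
      rw [← hJ v (Complex.I • a) b, hII]; simp
    rw [e, metricInChart_connection g p hy, metricInChart_connection g p hy]
    have h1 := hD (Complex.I • a) b (Complex.I • z)
    have h2 := hD (Complex.I • a) (Complex.I • b) z
    simp only [hII, map_neg, neg_apply, hJ] at h1 h2
    linarith [e' a b z, hs (Complex.I • b) a z, hs b a (Complex.I • z), e' b z a]

end Connection

/-! ### The rotational energy and its regularity up to the boundary. -/

section Energy

open Metric (closedBall ball sphere)

variable {E : Type*} [NormedAddCommGroup E] [NormedSpace ℂ E]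
  {M : Type*} [TopologicalSpace M] [ChartedSpace E M]

/-- The velocity of the rotations `θ ↦ u (e^{iθ} z)`, read in the preferred chart at `u z`. -/
def rotVelocity (u : ℂ → M) (z : ℂ) : E :=
  fderivWithin ℝ (extChartAt 𝓘(ℝ, E) (u z) ∘ u) (closedBall 0 1) z (Complex.I * z)

/-- The derivative of a map from the closed disc along the rotation field. -/
def rotDeriv (v : ℂ → E) (z : ℂ) : E := fderivWithin ℝ v (closedBall 0 1) z (Complex.I * z)

theorem uniqueDiffOn_closedDisc : UniqueDiffOn ℝ (closedBall (0 : ℂ) 1) :=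
  uniqueDiffOn_convex (convex_closedBall 0 1)
    (by rw [interior_closedBall _ one_ne_zero]; exact Metric.nonempty_ball.2 one_pos)

theorem contDiffWithinAt_rotDeriv {v : ℂ → E} {z : ℂ} (hz : z ∈ closedBall (0 : ℂ) 1)
    (hv : ContDiffWithinAt ℝ ∞ v (closedBall 0 1) z) :
    ContDiffWithinAt ℝ ∞ (rotDeriv v) (closedBall 0 1) z :=
  (hv.fderivWithin_right uniqueDiffOn_closedDisc (m := ∞) (by simp) hz).clm_apply
    (contDiffWithinAt_const.mul contDiffWithinAt_id)

variable [IsManifold 𝓘(ℂ, E) ω M] (g : Metric E M)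

/-- The squared norm of the rotational velocity. -/
def rotEnergy (u : ℂ → M) (z : ℂ) : ℝ := innerAt g (u z) (rotVelocity u z) (rotVelocity u z)

variable {u : ℂ → M}

theorem contDiffWithinAt_chart_comp (hu : ContMDiffOn 𝓘(ℝ, ℂ) 𝓘(ℝ, E) ∞ u (closedBall 0 1)) (p : M)
    {z : ℂ} (hz : z ∈ closedBall (0 : ℂ) 1) (hp : u z ∈ (chartAt E p).source) :
    ContDiffWithinAt ℝ ∞ (extChartAt 𝓘(ℝ, E) p ∘ u) (closedBall 0 1) z := by
  rw [← contMDiffWithinAt_iff_contDiffWithinAt]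
  exact (contMDiffAt_extChartAt' hp).comp_contMDiffWithinAt z (hu z hz)

omit [IsManifold 𝓘(ℂ, E) ω M] in
theorem eventually_mem_chart (hu : ContMDiffOn 𝓘(ℝ, ℂ) 𝓘(ℝ, E) ∞ u (closedBall 0 1)) (p : M)
    {z : ℂ} (hz : z ∈ closedBall (0 : ℂ) 1) (hp : u z ∈ (chartAt E p).source) :
    ∀ᶠ z' in nhdsWithin z (closedBall 0 1), u z' ∈ (chartAt E p).source :=
  (hu z hz).continuousWithinAt.eventually_mem ((chartAt E p).open_source.mem_nhds hp)

omit [IsManifold 𝓘(ℂ, E) ω M] in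
theorem chart_mem_target (p : M) {q : M} (hp : q ∈ (chartAt E p).source) :
    extChartAt 𝓘(ℝ, E) p q ∈ (extChartAt 𝓘(ℝ, E) p).target :=
  (extChartAt 𝓘(ℝ, E) p).map_source (by rwa [extChartAt_source])

omit [IsManifold 𝓘(ℂ, E) ω M] in
theorem pointAt_chart (p : M) {q : M} (hp : q ∈ (chartAt E p).source) :
    pointAt p (extChartAt 𝓘(ℝ, E) p q) = q :=
  (extChartAt 𝓘(ℝ, E) p).left_inv (by rwa [extChartAt_source])

/-- The chart in `rotVelocity` moves with `z`. The chain rule for the chart change replaces it by a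
fixed chart, where smoothness can be checked and derivatives taken. -/
theorem rotVelocity_eq (hu : ContMDiffOn 𝓘(ℝ, ℂ) 𝓘(ℝ, E) ∞ u (closedBall 0 1)) (p : M)
    {z : ℂ} (hz : z ∈ closedBall (0 : ℂ) 1) (hp : u z ∈ (chartAt E p).source) :
    rotVelocity u z = coordFrame p (extChartAt 𝓘(ℝ, E) p (u z))
      (rotDeriv (extChartAt 𝓘(ℝ, E) p ∘ u) z) := by
  have hv := ((contDiffWithinAt_chart_comp hu p hz hp).differentiableWithinAt
    (by simp)).hasFDerivWithinAt
  have hc := (differentiableAt_chart_change p (u z) (chart_mem_target p hp)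
    (by rw [pointAt_chart p hp]; exact mem_chart_source E _)).restrictScalars ℝ
  have h := hc.hasFDerivAt.comp_hasFDerivWithinAt z hv
  have h2 := h.congr_of_eventuallyEq (f₁ := extChartAt 𝓘(ℝ, E) (u z) ∘ u)
    (by
      filter_upwards [eventually_mem_chart hu p hz hp] with z' hz'
      simp only [Function.comp_apply]
      exact congrArg _ (pointAt_chart p hz').symm)
    (by
      simp only [Function.comp_apply]
      exact congrArg _ (pointAt_chart p hp).symm)
  rw [rotVelocity, h2.fderivWithin (uniqueDiffOn_closedDisc z hz), coordFrame, pointAt_chart p hp]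
  rfl

theorem rotEnergy_eq (hu : ContMDiffOn 𝓘(ℝ, ℂ) 𝓘(ℝ, E) ∞ u (closedBall 0 1)) (p : M)
    {z : ℂ} (hz : z ∈ closedBall (0 : ℂ) 1) (hp : u z ∈ (chartAt E p).source) :
    rotEnergy g u z = metricInChart g p (extChartAt 𝓘(ℝ, E) p (u z))
      (rotDeriv (extChartAt 𝓘(ℝ, E) p ∘ u) z) (rotDeriv (extChartAt 𝓘(ℝ, E) p ∘ u) z) := by
  rw [metricInChart_apply g p (chart_mem_target p hp), ← rotVelocity_eq hu p hz hp,
    pointAt_chart p hp, rotEnergy]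

theorem rotEnergy_nonneg (z : ℂ) : 0 ≤ rotEnergy g u z := by
  by_cases h : (rotVelocity u z : E) = 0
  · simp [rotEnergy, h]
  · exact (innerAt_pos g _ h).le

theorem rotEnergy_zero : rotEnergy g u 0 = 0 := by
  simp [rotEnergy, rotVelocity]

theorem contDiffOn_rotEnergy [FiniteDimensional ℂ E]
    (hu : ContMDiffOn 𝓘(ℝ, ℂ) 𝓘(ℝ, E) ∞ u (closedBall 0 1)) :
    ContDiffOn ℝ ∞ (rotEnergy g u) (closedBall 0 1) := by
  intro z hz
  have hp := mem_chart_source E (u z)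
  have hv := contDiffWithinAt_chart_comp hu (u z) hz hp
  have hX := contDiffWithinAt_rotDeriv hz hv
  have hG : ContDiffWithinAt ℝ ∞ (fun z' => metricInChart g (u z) (extChartAt 𝓘(ℝ, E) (u z) (u z')))
      (closedBall 0 1) z :=
    ContDiffAt.comp_contDiffWithinAt (F := E) (G := E →L[ℝ] E →L[ℝ] ℝ) z
      ((contDiffOn_metricInChart g (u z)).contDiffAt
        ((isOpen_chart_target _).mem_nhds (chart_mem_target _ hp))) hv
  refine ((hG.clm_apply hX).clm_apply hX).congr_of_eventuallyEq_of_mem ?_ hz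
  filter_upwards [eventually_mem_chart hu (u z) hz hp, self_mem_nhdsWithin] with z' h1 h2
  exact rotEnergy_eq g hu (u z) h2 h1

end Energy

/-! ### From sectional curvature to the curvature of the model. -/

section Curvature

variable {E : Type*} [NormedAddCommGroup E] [NormedSpace ℂ E] [FiniteDimensional ℂ E]
  {M : Type*} [TopologicalSpace M] [ChartedSpace E M] [IsManifold 𝓘(ℂ, E) ω M] {g : Metric E M}

theorem fderiv_connection_apply (p : M) {y : E} (hy : y ∈ (extChartAt 𝓘(ℝ, E) p).target)
    (a b c : E) :
    fderiv ℝ (fun z => christoffel g p z b c) y a = fderiv ℝ (connection g p) y a b c := by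
  have h := (((contDiffOn_connection g p).differentiableOn (by simp)).differentiableAt
    ((isOpen_chart_target p).mem_nhds hy)).hasFDerivAt
  have h1 := HasFDerivAt.clm_apply (G := E) (H := E →L[ℝ] E) h (hasFDerivAt_const b y)
  have h2 := HasFDerivAt.clm_apply h1 (hasFDerivAt_const c y)
  have h3 := h2.fderiv
  simp only [connection_apply] at h3
  rw [h3]
  simp

theorem curvature_eq (p : M) (a b c : E) :
    (curvature g p a b c : E)
      = modelCurvature (connection g p) (extChartAt 𝓘(ℝ, E) p p) a b c := by
  have hy := mem_extChartAt_target (I := 𝓘(ℝ, E)) p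
  rw [modelCurvature, ← fderiv_connection_apply p hy, ← fderiv_connection_apply p hy]
  rfl

/-- The holomorphic sectional curvature is nonpositive. -/
theorem NonposSectionalCurvature.holomorphic (hg : IsKahler g) (hK : NonposSectionalCurvature g)
    (p : M) (w : E) :
    innerAt g p (modelCurvature (connection g p) (extChartAt 𝓘(ℝ, E) p p) w (Complex.I • w)
      (Complex.I • w)) w ≤ 0 := by
  by_cases hw : w = 0
  · simp [hw]
  have hww := innerAt_pos g p hw
  have hJ : innerAt g p (Complex.I • w) (Complex.I • w) = innerAt g p w w := hg.innerAt_I_smul p w w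
  have hwJ : innerAt g p w (Complex.I • w) = 0 := by
    have h := hg.innerAt_I_smul p w (Complex.I • w)
    rw [smul_smul, Complex.I_mul_I, neg_one_smul, map_neg, innerAt_symm] at h
    linarith
  have hli : LinearIndependent ℝ ![w, Complex.I • w] := by
    rw [LinearIndependent.pair_iff]
    intro s t hst
    have h1 : innerAt g p w (s • w + t • Complex.I • w) = 0 := by rw [hst, map_zero]
    have h2 : innerAt g p (Complex.I • w) (s • w + t • Complex.I • w) = 0 := by rw [hst, map_zero]
    rw [map_add, (innerAt g p w).map_smul s, (innerAt g p w).map_smul t, hwJ] at h1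
    rw [map_add, (innerAt g p _).map_smul s, (innerAt g p _).map_smul t, hJ, innerAt_symm, hwJ] at h2
    simp only [smul_eq_mul, mul_zero, add_zero, zero_add, mul_eq_zero, hww.ne', or_false] at h1 h2
    exact ⟨h1, h2⟩
  have h : innerAt g p (curvature g p w (Complex.I • w : E) (Complex.I • w : E)) w
      / (innerAt g p w w * innerAt g p (Complex.I • w) (Complex.I • w)
        - innerAt g p w (Complex.I • w) ^ 2) ≤ 0 := hK p w (Complex.I • w : E) hli
  rw [hJ, hwJ, curvature_eq] at h
  -- The vectors `w` and `iw` are orthogonal of equal length, so the denominator is `|w|⁴ > 0` and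
  -- the sign of the quotient is that of the numerator.
  by_contra hc
  push Not at hc
  have := div_pos hc (show 0 < innerAt g p w w * innerAt g p w w - 0 ^ 2 by nlinarith)
  linarith

end Curvature

/-! ### Interior computations in the logarithmic coordinate. -/

section Interior

open Metric (closedBall ball sphere)

variable {E : Type*} [NormedAddCommGroup E] [NormedSpace ℂ E]
  {M : Type*} [TopologicalSpace M] [ChartedSpace E M]

theorem exp_mem_closedBall {ζ : ℂ} (h : ζ.re ≤ 0) : Complex.exp ζ ∈ closedBall (0 : ℂ) 1 := by
  rw [mem_closedBall_zero_iff, Complex.norm_exp]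
  exact Real.exp_le_one_iff.2 h

theorem exp_mem_ball {ζ : ℂ} (h : ζ.re < 0) : Complex.exp ζ ∈ ball (0 : ℂ) 1 := by
  rw [mem_ball_zero_iff, Complex.norm_exp]
  exact (Real.exp_lt_exp.2 h).trans_eq Real.exp_zero

theorem hasDerivAt_exp_line (ζ τ : ℂ) (t : ℝ) :
    HasDerivAt (fun s : ℝ => Complex.exp (ζ + s * τ)) (τ * Complex.exp (ζ + t * τ)) t := by
  have h1 : HasDerivAt (fun s : ℝ => ζ + s * τ) τ t := by
    simpa using ((Complex.ofRealCLM.hasDerivAt (x := t)).mul_const τ).const_add ζ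
  simpa [mul_comm] using h1.cexp

theorem hasDerivAt_rotation {W : Type*} [NormedAddCommGroup W] [NormedSpace ℝ W] {w : ℂ → W}
    {ζ : ℂ} (hζ : ζ.re ≤ 0) (t : ℝ)
    (hw : DifferentiableWithinAt ℝ w (closedBall 0 1) (Complex.exp (ζ + t * Complex.I))) :
    HasDerivAt (fun s : ℝ => w (Complex.exp (ζ + s * Complex.I)))
      (fderivWithin ℝ w (closedBall 0 1) (Complex.exp (ζ + t * Complex.I))
        (Complex.I * Complex.exp (ζ + t * Complex.I))) t :=
  hw.hasFDerivWithinAt.comp_hasDerivAt t (hasDerivAt_exp_line ζ Complex.I t)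
    (Filter.Eventually.of_forall fun s => exp_mem_closedBall (by simpa using hζ))

/-- The part of the left half plane that `u ∘ exp` maps into the preferred chart at `p`. -/
def chartDomain (u : ℂ → M) (p : M) : Set ℂ :=
  {ζ | ζ.re < 0 ∧ u (Complex.exp ζ) ∈ (chartAt E p).source}

/-- The map `u ∘ exp`, read in the preferred chart at `p`. -/
def chartLift (u : ℂ → M) (p : M) (ζ : ℂ) : E := extChartAt 𝓘(ℝ, E) p (u (Complex.exp ζ))

variable [IsManifold 𝓘(ℂ, E) ω M] {u : ℂ → M}

omit [IsManifold 𝓘(ℂ, E) ω M] in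
theorem isOpen_chartDomain (hu : ContMDiffOn 𝓘(ℝ, ℂ) 𝓘(ℝ, E) ∞ u (closedBall 0 1)) (p : M) :
    IsOpen (chartDomain (E := E) u p) := by
  have h1 : ContinuousOn (fun ζ => u (Complex.exp ζ)) {ζ | ζ.re < 0} :=
    hu.continuousOn.comp Complex.continuous_exp.continuousOn fun ζ hζ => exp_mem_closedBall hζ.le
  exact h1.isOpen_inter_preimage (isOpen_lt Complex.continuous_re continuous_const)
    (chartAt E p).open_source

theorem differentiableAt_chart_comp (hol : MDifferentiableOn 𝓘(ℂ, ℂ) 𝓘(ℂ, E) u (ball 0 1)) (p : M)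
    {z : ℂ} (hz : z ∈ ball (0 : ℂ) 1) (hp : u z ∈ (chartAt E p).source) :
    DifferentiableAt ℂ (extChartAt 𝓘(ℝ, E) p ∘ u) z := by
  have : IsManifold 𝓘(ℂ, E) 1 M := IsManifold.of_le (n := ω) (by simp)
  have h1 : MDifferentiableAt 𝓘(ℂ, E) 𝓘(ℂ, E) (extChartAt 𝓘(ℂ, E) p) (u z) :=
    mdifferentiableAt_extChartAt hp
  exact (h1.comp z (hol.mdifferentiableAt (Metric.isOpen_ball.mem_nhds hz))).differentiableAt

theorem hasDerivAt_chartLift (hol : MDifferentiableOn 𝓘(ℂ, ℂ) 𝓘(ℂ, E) u (ball 0 1)) (p : M)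
    {ζ : ℂ} (hζ : ζ ∈ chartDomain (E := E) u p) :
    HasDerivAt (chartLift (E := E) u p)
      (Complex.exp ζ • deriv (extChartAt 𝓘(ℝ, E) p ∘ u) (Complex.exp ζ)) ζ :=
  HasDerivAt.scomp ζ (differentiableAt_chart_comp hol p (exp_mem_ball hζ.1) hζ.2).hasDerivAt
    (Complex.hasDerivAt_exp ζ)

theorem differentiableOn_chartLift (hol : MDifferentiableOn 𝓘(ℂ, ℂ) 𝓘(ℂ, E) u (ball 0 1)) (p : M) :
    DifferentiableOn ℂ (chartLift (E := E) u p) (chartDomain (E := E) u p) := fun _ hζ =>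
  (hasDerivAt_chartLift hol p hζ).differentiableAt.differentiableWithinAt

omit [IsManifold 𝓘(ℂ, E) ω M] in
theorem mapsTo_chartLift (p : M) : Set.MapsTo (chartLift (E := E) u p) (chartDomain (E := E) u p)
    (extChartAt 𝓘(ℝ, E) p).target := fun _ hζ => chart_mem_target p hζ.2

/-- Rotation of the disc is translation of `ζ` in the direction `i`, and `V` is holomorphic. -/
theorem rotDeriv_exp (hol : MDifferentiableOn 𝓘(ℂ, ℂ) 𝓘(ℂ, E) u (ball 0 1)) (p : M)
    {ζ : ℂ} (hζ : ζ ∈ chartDomain (E := E) u p) :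
    rotDeriv (extChartAt 𝓘(ℝ, E) p ∘ u) (Complex.exp ζ)
      = Complex.I • deriv (chartLift (E := E) u p) ζ := by
  have hd := differentiableAt_chart_comp hol p (exp_mem_ball hζ.1) hζ.2
  rw [(hasDerivAt_chartLift hol p hζ).deriv, rotDeriv, fderivWithin_of_mem_nhds
    (Filter.mem_of_superset (Metric.isOpen_ball.mem_nhds (exp_mem_ball hζ.1))
      Metric.ball_subset_closedBall), hd.fderiv_restrictScalars ℝ, smul_smul]
  exact fderiv_eq_smul_deriv _

section

variable [FiniteDimensional ℂ E] {g : Metric E M}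

omit [FiniteDimensional ℂ E] in
theorem rotEnergy_exp (hg : IsKahler g)
    (hu : ContMDiffOn 𝓘(ℝ, ℂ) 𝓘(ℝ, E) ∞ u (closedBall 0 1))
    (hol : MDifferentiableOn 𝓘(ℂ, ℂ) 𝓘(ℂ, E) u (ball 0 1)) (p : M)
    {ζ : ℂ} (hζ : ζ ∈ chartDomain (E := E) u p) :
    rotEnergy g u (Complex.exp ζ) = metricInChart g p (chartLift u p ζ)
      (deriv (chartLift (E := E) u p) ζ) (deriv (chartLift (E := E) u p) ζ) := by
  rw [rotEnergy_eq g hu p (exp_mem_closedBall hζ.1.le) hζ.2, rotDeriv_exp hol p hζ,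
    hg.metricInChart_I_smul p (chart_mem_target p hζ.2)]
  rfl

theorem eventually_line_mem {O : Set ℂ} (hO : IsOpen O) {ζ : ℂ} (hζ : ζ ∈ O) (τ : ℂ) :
    ∀ᶠ t : ℝ in nhds 0, ζ + t * τ ∈ O := by
  have : ContinuousAt (fun t : ℝ => ζ + t * τ) 0 := by fun_prop
  exact this.eventually_mem (hO.mem_nhds (by simpa using hζ))

theorem eventually_hasDerivAt_rotEnergy (hg : IsKahler g)
    (hu : ContMDiffOn 𝓘(ℝ, ℂ) 𝓘(ℝ, E) ∞ u (closedBall 0 1))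
    (hol : MDifferentiableOn 𝓘(ℂ, ℂ) 𝓘(ℂ, E) u (ball 0 1)) (p : M)
    {ζ : ℂ} (hζ : ζ ∈ chartDomain (E := E) u p) (τ : ℂ) :
    ∀ᶠ t : ℝ in nhds 0, HasDerivAt (fun s : ℝ => rotEnergy g u (Complex.exp (ζ + s * τ)))
      (2 * metricInChart g p (chartLift u p (ζ + t * τ))
        (τ • covAccel (connection g p) (chartLift u p) (ζ + t * τ))
        (deriv (chartLift (E := E) u p) (ζ + t * τ))) t := by
  have : CompleteSpace E := FiniteDimensional.complete ℂ E
  have hO := isOpen_chartDomain hu p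
  have hev := eventually_line_mem hO hζ τ
  filter_upwards [hev.eventually_nhds] with t ht
  refine ((hg.isKahlerModel p).hasDerivAt_energy hO (differentiableOn_chartLift hol p)
    (mapsTo_chartLift p) ζ τ t ht.self_of_nhds).congr_of_eventuallyEq ?_
  filter_upwards [ht] with s hs using rotEnergy_exp hg hu hol p hs

/-- The rotational energy is subharmonic in the logarithmic coordinate. -/
theorem exists_rotEnergy_second_derivs (hg : IsKahler g) (hK : NonposSectionalCurvature g)
    (hu : ContMDiffOn 𝓘(ℝ, ℂ) 𝓘(ℝ, E) ∞ u (closedBall 0 1))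
    (hol : MDifferentiableOn 𝓘(ℂ, ℂ) 𝓘(ℂ, E) u (ball 0 1)) {ζ : ℂ} (hζ : ζ.re < 0) :
    ∃ (α β : ℝ → ℝ) (a b : ℝ), 0 ≤ a + b ∧ HasDerivAt α a 0 ∧ HasDerivAt β b 0 ∧
      (∀ᶠ t : ℝ in nhds 0,
        HasDerivAt (fun s : ℝ => rotEnergy g u (Complex.exp (ζ + s * 1))) (α t) t) ∧
      (∀ᶠ t : ℝ in nhds 0,
        HasDerivAt (fun s : ℝ => rotEnergy g u (Complex.exp (ζ + s * Complex.I))) (β t) t) := by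
  have : CompleteSpace E := FiniteDimensional.complete ℂ E
  set p := u (Complex.exp ζ) with hp
  have hm : ζ ∈ chartDomain (E := E) u p := ⟨hζ, mem_chart_source E _⟩
  have hcurv := hK.holomorphic hg p (deriv (chartLift (E := E) u p) ζ)
  rw [← metricInChart_center] at hcurv
  obtain ⟨a, b, hab, ha, hb⟩ := (hg.isKahlerModel p).exists_second_derivs (isOpen_chartDomain hu p)
    (differentiableOn_chartLift hol p) (mapsTo_chartLift p) hm hcurv
  exact ⟨_, _, a, b, hab, ha, hb, eventually_hasDerivAt_rotEnergy hg hu hol p hm 1,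
    eventually_hasDerivAt_rotEnergy hg hu hol p hm Complex.I⟩

/-- The covariant derivative of the rotational velocity along itself, in the chart at `p`. -/
def rotAccel (g : Metric E M) (u : ℂ → M) (p : M) (z : ℂ) : E :=
  rotDeriv (rotDeriv (extChartAt 𝓘(ℝ, E) p ∘ u)) z
    + connection g p (extChartAt 𝓘(ℝ, E) p (u z)) (rotDeriv (extChartAt 𝓘(ℝ, E) p ∘ u) z)
      (rotDeriv (extChartAt 𝓘(ℝ, E) p ∘ u) z)

/-- With `X = iV'`, both terms of `∇_X X` acquire the factor `i² = -1`. -/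
theorem rotAccel_exp (hg : IsKahler g)
    (hu : ContMDiffOn 𝓘(ℝ, ℂ) 𝓘(ℝ, E) ∞ u (closedBall 0 1))
    (hol : MDifferentiableOn 𝓘(ℂ, ℂ) 𝓘(ℂ, E) u (ball 0 1)) (p : M)
    {ζ : ℂ} (hζ : ζ ∈ chartDomain (E := E) u p) :
    rotAccel g u p (Complex.exp ζ) = -covAccel (connection g p) (chartLift u p) ζ := by
  have : CompleteSpace E := FiniteDimensional.complete ℂ E
  have hy := mapsTo_chartLift p hζ
  have hO := isOpen_chartDomain hu p
  have hev := eventually_line_mem hO hζ Complex.I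
  have hv := contDiffWithinAt_rotDeriv (exp_mem_closedBall hζ.1.le)
    (contDiffWithinAt_chart_comp hu p (exp_mem_closedBall hζ.1.le) hζ.2)
  have h1 := hasDerivAt_rotation (ζ := ζ) hζ.1.le 0
    (w := rotDeriv (extChartAt 𝓘(ℝ, E) p ∘ u)) (by simpa using hv.differentiableWithinAt (by simp))
  have h2 := (IsKahlerModel.hasDerivAt_line hO ((differentiableOn_chartLift hol p).deriv hO) ζ
    Complex.I 0 (by simpa using hζ)).const_smul Complex.I
  have h3 := h1.unique (h2.congr_of_eventuallyEq (by
    filter_upwards [hev] with t ht using rotDeriv_exp hol p ht))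
  simp only [Complex.ofReal_zero, zero_mul, add_zero, smul_smul, Complex.I_mul_I,
    neg_one_smul] at h3
  have h4 : rotDeriv (rotDeriv (extChartAt 𝓘(ℝ, E) p ∘ u)) (Complex.exp ζ)
      = -deriv (deriv (chartLift (E := E) u p)) ζ := h3
  rw [rotAccel, h4, rotDeriv_exp hol p hζ, covAccel]
  have h5 := (hg.isKahlerModel p).smul_left hy Complex.I
  have h6 := (hg.isKahlerModel p).smul_right hy Complex.I
  rw [chartLift] at h5 h6
  rw [h5, h6, smul_smul, Complex.I_mul_I, neg_one_smul, chartLift, neg_add]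

/-- The radial derivative of the rotational energy in the interior of the disc. -/
theorem radial_deriv_rotEnergy (hg : IsKahler g)
    (hu : ContMDiffOn 𝓘(ℝ, ℂ) 𝓘(ℝ, E) ∞ u (closedBall 0 1))
    (hol : MDifferentiableOn 𝓘(ℂ, ℂ) 𝓘(ℂ, E) u (ball 0 1)) (p : M) {z : ℂ} (hz : z ∈ ball (0 : ℂ) 1)
    (hz0 : z ≠ 0) (hp : u z ∈ (chartAt E p).source) :
    fderivWithin ℝ (rotEnergy g u) (closedBall 0 1) z z
      = 2 * metricInChart g p (extChartAt 𝓘(ℝ, E) p (u z)) (rotAccel g u p z)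
        (Complex.I • rotDeriv (extChartAt 𝓘(ℝ, E) p ∘ u) z) := by
  set ζ := Complex.log z with hζ
  have e : Complex.exp ζ = z := Complex.exp_log hz0
  have hre : ζ.re < 0 := by
    rw [hζ, Complex.log_re]
    exact Real.log_neg (norm_pos_iff.2 hz0) (mem_ball_zero_iff.1 hz)
  have hm : ζ ∈ chartDomain (E := E) u p := ⟨hre, by rwa [e]⟩
  have hy := mapsTo_chartLift p hm
  -- Radial motion is translation of `ζ` in the direction `1`, which gives `2 g(∇_{V'} V', V')`.
  -- Replacing `∇_{V'} V'` by `-∇_X X` and `V'` by `-iX` leaves the sign unchanged.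
  have h1 := (eventually_hasDerivAt_rotEnergy hg hu hol p hm 1).self_of_nhds
  have hn : closedBall (0 : ℂ) 1 ∈ nhds z :=
    Filter.mem_of_superset (Metric.isOpen_ball.mem_nhds hz) Metric.ball_subset_closedBall
  have hd : HasFDerivAt (rotEnergy g u) (fderivWithin ℝ (rotEnergy g u) (closedBall 0 1) z)
      (Complex.exp (ζ + (0 : ℝ) * 1)) := by
    have := (((contDiffOn_rotEnergy g hu).differentiableOn (by simp)) z
      (Metric.ball_subset_closedBall hz)).hasFDerivWithinAt.hasFDerivAt hn
    simpa [e] using this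
  have h2 := hd.comp_hasDerivAt 0 (hasDerivAt_exp_line ζ 1 0)
  have h3 := h2.unique h1
  simp only [Complex.ofReal_zero, zero_mul, add_zero, one_mul, e, one_smul] at h3
  rw [h3, ← e, rotAccel_exp hg hu hol p hm, rotDeriv_exp hol p hm, smul_smul, Complex.I_mul_I,
    neg_one_smul, map_neg, map_neg, neg_apply, neg_neg]
  rfl

end

end Interior

/-! ### Maximum principle with Neumann boundary condition. -/

section MaximumPrinciple

open Metric (closedBall ball sphere)

/-- If `d > 0`, the second derivative test makes the point a local minimum as well, so `φ` is
locally constant and `d = 0`. -/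
theorem second_deriv_nonpos_of_isLocalMax {φ α : ℝ → ℝ} {d : ℝ}
    (hφ : ∀ᶠ t in nhds 0, HasDerivAt φ (α t) t) (hα : HasDerivAt α d 0) (h : IsLocalMax φ 0) :
    d ≤ 0 := by
  by_contra hd
  push Not at hd
  have e : deriv φ =ᶠ[nhds 0] α := hφ.mono fun t ht => ht.deriv
  have h0 : deriv φ 0 = 0 := h.deriv_eq_zero
  have hdd : deriv (deriv φ) 0 = d := by rw [e.deriv_eq, hα.deriv]
  have hmin : IsLocalMin φ 0 := isLocalMin_of_deriv_deriv_pos (hdd ▸ hd) h0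
    hφ.self_of_nhds.continuousAt
  have hc : φ =ᶠ[nhds 0] fun _ => φ 0 := by
    filter_upwards [h, hmin] with t h1 h2 using le_antisymm h1 h2
  have hz : deriv φ =ᶠ[nhds 0] fun _ => 0 := by
    filter_upwards [hc.eventually_nhds] with t ht
    rw [Filter.EventuallyEq.deriv_eq ht, deriv_const]
  rw [hz.deriv_eq, deriv_const] at hdd
  exact hd.ne hdd

/-- In the coordinate `ζ = log z` the added terms are `-c Re ζ + c (Re ζ)²`. The quadratic one
contributes `2c > 0` to the Laplacian, so the sum has no interior maximum on the annulus. On the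
outer circle the added terms vanish; the inner circle is a hypothesis. -/
theorem exists_radial_barrier {f : ℂ → ℝ} (hf : ContinuousOn f (closedBall 0 1))
    (hsub : ∀ ζ : ℂ, ζ.re < 0 → ∃ (α β : ℝ → ℝ) (a b : ℝ), 0 ≤ a + b ∧
      HasDerivAt α a 0 ∧ HasDerivAt β b 0 ∧
      (∀ᶠ t : ℝ in nhds 0, HasDerivAt (fun s : ℝ => f (Complex.exp (ζ + s * 1))) (α t) t) ∧
      (∀ᶠ t : ℝ in nhds 0, HasDerivAt (fun s : ℝ => f (Complex.exp (ζ + s * Complex.I))) (β t) t))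
    {m δ c : ℝ} (hδ : 0 < δ) (hc : 0 < c) (hm : ∀ z ∈ closedBall (0 : ℂ) 1, f z ≤ m)
    (hmδ : ∀ z : ℂ, ‖z‖ = δ → f z - c * Real.log δ + c * Real.log δ ^ 2 ≤ m) :
    ∀ z ∈ closedBall (0 : ℂ) 1, δ ≤ ‖z‖ →
      f z - c * Real.log ‖z‖ + c * Real.log ‖z‖ ^ 2 ≤ m := by
  intro z hz hzδ
  set A : Set ℂ := closedBall 0 1 ∩ {z | δ ≤ ‖z‖} with hA
  have hAc : IsCompact A := (isCompact_closedBall 0 1).inter_right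
    (isClosed_le continuous_const continuous_norm)
  have hlog : ContinuousOn (fun z : ℂ => Real.log ‖z‖) A :=
    continuous_norm.continuousOn.log fun w hw => (hδ.trans_le hw.2).ne'
  have hk : ContinuousOn (fun z : ℂ => f z - c * Real.log ‖z‖ + c * Real.log ‖z‖ ^ 2) A :=
    ((hf.mono Set.inter_subset_left).sub (continuousOn_const.mul hlog)).add
      (continuousOn_const.mul (hlog.pow 2))
  obtain ⟨w, hwA, hw⟩ := hAc.exists_isMaxOn ⟨z, hz, hzδ⟩ hk
  refine (hw ⟨hz, hzδ⟩).trans ?_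
  simp only
  rcases eq_or_lt_of_le (show δ ≤ ‖w‖ from hwA.2) with h1 | h1
  · rw [← h1]; exact hmδ w h1.symm
  rcases eq_or_lt_of_le (mem_closedBall_zero_iff.1 hwA.1) with h2 | h2
  · rw [h2]; simpa using hm w hwA.1
  exfalso
  have hw0 : w ≠ 0 := norm_pos_iff.1 (hδ.trans h1)
  set ζ := Complex.log w with hζ
  have hew : Complex.exp ζ = w := Complex.exp_log hw0
  have hre : ζ.re < 0 := by
    rw [hζ, Complex.log_re]; exact Real.log_neg (hδ.trans h1) h2
  obtain ⟨α, β, a, b, hab, ha, hb, h3, h4⟩ := hsub ζ hre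
  have hAn : A ∈ nhds w := by
    have : {z : ℂ | ‖z‖ < 1} ∩ {z | δ < ‖z‖} ∈ nhds w :=
      ((isOpen_lt continuous_norm continuous_const).inter
        (isOpen_lt continuous_const continuous_norm)).mem_nhds ⟨h2, h1⟩
    exact Filter.mem_of_superset this fun z hz =>
      ⟨mem_closedBall_zero_iff.2 (le_of_lt hz.1), le_of_lt (show δ < ‖z‖ from hz.2)⟩
  have hmax : ∀ τ : ℂ, IsLocalMax (fun s : ℝ => f (Complex.exp (ζ + s * τ))
      - c * (ζ + s * τ).re + c * (ζ + s * τ).re ^ 2) 0 := by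
    intro τ
    have hcont : ContinuousAt (fun s : ℝ => Complex.exp (ζ + s * τ)) 0 := by fun_prop
    have hev : ∀ᶠ s : ℝ in nhds 0, Complex.exp (ζ + s * τ) ∈ A :=
      hcont.eventually_mem (by simpa [hew] using hAn)
    filter_upwards [hev] with s hs
    have h : f (Complex.exp (ζ + s * τ)) - c * Real.log ‖Complex.exp (ζ + s * τ)‖
        + c * Real.log ‖Complex.exp (ζ + s * τ)‖ ^ 2
        ≤ f w - c * Real.log ‖w‖ + c * Real.log ‖w‖ ^ 2 := hw hs
    rw [Complex.norm_exp, Real.log_exp, ← Complex.log_re w] at h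
    simpa only [Complex.ofReal_zero, zero_mul, add_zero, hew] using h
  have hd : ∀ (ρ t : ℝ), HasDerivAt (fun s : ℝ => ζ.re + s * ρ) ρ t := fun ρ t => by
    simpa using ((hasDerivAt_id t).mul_const ρ).const_add ζ.re
  have e1 : a + 2 * c ≤ 0 := by
    refine second_deriv_nonpos_of_isLocalMax (α := fun t => α t - c + 2 * c * (ζ.re + t * 1))
      (h3.mono fun t ht => ?_) ?_ (hmax 1)
    · simp only [Complex.add_re, Complex.re_ofReal_mul, Complex.one_re]
      refine ((ht.sub ((hd 1 t).const_mul c)).add (((hd 1 t).pow 2).const_mul c)).congr_deriv ?_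
      ring
    · refine ((ha.sub_const c).add ((hd 1 0).const_mul (2 * c))).congr_deriv ?_
      ring
  have e2 : b ≤ 0 := by
    refine second_deriv_nonpos_of_isLocalMax (α := β) (h4.mono fun t ht => ?_) hb (hmax Complex.I)
    simp only [Complex.add_re, Complex.re_ofReal_mul, Complex.I_re, mul_zero, add_zero]
    exact (ht.sub_const _).add_const _
  linarith

/-- A function on the closed disc, subharmonic in the logarithmic coordinate, that vanishes at the
centre and satisfies the Neumann boundary condition, is nonpositive. -/
theorem nonpos_of_neumann {f : ℂ → ℝ} (hf : DifferentiableOn ℝ f (closedBall 0 1))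
    (hsub : ∀ ζ : ℂ, ζ.re < 0 → ∃ (α β : ℝ → ℝ) (a b : ℝ), 0 ≤ a + b ∧
      HasDerivAt α a 0 ∧ HasDerivAt β b 0 ∧
      (∀ᶠ t : ℝ in nhds 0, HasDerivAt (fun s : ℝ => f (Complex.exp (ζ + s * 1))) (α t) t) ∧
      (∀ᶠ t : ℝ in nhds 0, HasDerivAt (fun s : ℝ => f (Complex.exp (ζ + s * Complex.I))) (β t) t))
    (h0 : f 0 = 0)
    (hN : ∀ z ∈ sphere (0 : ℂ) 1, fderivWithin ℝ f (closedBall 0 1) z z = 0) :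
    ∀ z ∈ closedBall (0 : ℂ) 1, f z ≤ 0 := by
  by_contra! hcon
  obtain ⟨z₁, hz₁, hpos⟩ := hcon
  obtain ⟨w, hwS, hw⟩ := (isCompact_closedBall (0 : ℂ) 1).exists_isMaxOn ⟨z₁, hz₁⟩ hf.continuousOn
  set m := f w with hm
  have hm0 : 0 < m := hpos.trans_le (hw hz₁)
  have hev := (hf.continuousOn 0 (by simp)).eventually_lt_const (show f 0 < m / 2 by rw [h0]; linarith)
  obtain ⟨ε, hε, hball⟩ := Metric.mem_nhdsWithin_iff.1 hev
  obtain ⟨δ, hδ0, hδ⟩ := exists_between (lt_min hε one_pos)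
  have hδ1 : δ < 1 := hδ.trans_le (min_le_right _ _)
  have hsmall : ∀ z : ℂ, ‖z‖ ≤ δ → f z < m / 2 := fun z hz =>
    hball ⟨mem_ball_zero_iff.2 (hz.trans_lt (hδ.trans_le (min_le_left _ _))),
      mem_closedBall_zero_iff.2 (hz.trans hδ1.le)⟩
  have hT : Real.log δ < 0 := Real.log_neg hδ0 hδ1
  have hD : 0 < Real.log δ ^ 2 - Real.log δ := by nlinarith
  -- On the circle of radius `δ` the added terms then equal `m / 2`, which is the room left by `f <
  -- m / 2` there.
  set c := m / (2 * (Real.log δ ^ 2 - Real.log δ)) with hc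
  have hc0 : 0 < c := by positivity
  have hcD : c * (Real.log δ ^ 2 - Real.log δ) = m / 2 := by
    rw [hc, mul_comm 2, ← div_div, div_right_comm, div_mul_cancel₀ _ hD.ne']
  have hbar := exists_radial_barrier hf.continuousOn hsub hδ0 hc0 (fun z hz => hw hz)
    (fun z hz => by have := hsmall z hz.le; linarith)
  have hwδ : δ ≤ ‖w‖ := by
    by_contra! h
    have := hsmall w h.le
    linarith
  -- The added terms are strictly positive inside the unit circle, so `f w = m` would break the
  -- barrier bound there.
  have hw1 : ‖w‖ = 1 := by
    refine le_antisymm (mem_closedBall_zero_iff.1 hwS) ?_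
    by_contra! h
    have h1 := hbar w hwS hwδ
    have h2 : Real.log ‖w‖ < 0 := Real.log_neg (hδ0.trans_le hwδ) h
    have : 0 < c * (Real.log ‖w‖ ^ 2 - Real.log ‖w‖) := mul_pos hc0 (by nlinarith)
    linarith
  have hcurve : HasDerivWithinAt (fun r : ℝ => (r : ℂ) * w) w (Set.Icc δ 1) 1 := by
    simpa using ((Complex.ofRealCLM.hasDerivAt (x := 1)).mul_const w).hasDerivWithinAt
  have hmaps : Set.MapsTo (fun r : ℝ => (r : ℂ) * w) (Set.Icc δ 1) (closedBall 0 1) := by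
    intro r hr
    rw [mem_closedBall_zero_iff, norm_mul, hw1, mul_one, Complex.norm_real, Real.norm_eq_abs,
      abs_of_pos (hδ0.trans_le hr.1)]
    exact hr.2
  have hfw : HasFDerivWithinAt f (fderivWithin ℝ f (closedBall 0 1) w) (closedBall 0 1)
      ((fun r : ℝ => (r : ℂ) * w) 1) := by
    simpa using (hf w hwS).hasFDerivWithinAt
  have h1 := hfw.comp_hasDerivWithinAt 1 hcurve hmaps
  rw [hN w (by simpa using hw1)] at h1
  have h2 : HasDerivWithinAt Real.log 1 (Set.Icc δ 1) 1 := by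
    simpa using (Real.hasDerivAt_log one_ne_zero).hasDerivWithinAt
  have h3 := (h1.sub (h2.const_mul c)).add ((h2.pow 2).const_mul c)
  have hmax : IsMaxOn (fun r : ℝ => f (r * w) - c * Real.log r + c * Real.log r ^ 2)
      (Set.Icc δ 1) 1 := by
    intro r hr
    have hr0 := hδ0.trans_le hr.1
    have hn : ‖(r : ℂ) * w‖ = r := by
      rw [norm_mul, hw1, mul_one, Complex.norm_real, Real.norm_eq_abs, abs_of_pos hr0]
    have := hbar (r * w) (hmaps hr) (by rw [hn]; exact hr.1)
    rw [hn] at this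
    simpa using this
  -- The radial function is maximal at the endpoint `1`, yet by the Neumann condition its derivative
  -- there is `0 - c + 0 < 0`. Moving inwards, by `δ - 1`, gives the contradiction.
  have h4 := hmax.localize.hasFDerivWithinAt_nonpos h3.hasFDerivWithinAt
    (y := δ - 1) (mem_posTangentConeAt_of_segment_subset (by
      rw [add_sub_cancel, segment_symm, segment_eq_Icc hδ1.le]))
  simp at h4
  nlinarith

end MaximumPrinciple

/-! ### The Neumann condition where the boundary lifts to `L`. -/

section Boundary

open Metric (closedBall ball sphere)

variable {E : Type*} [NormedAddCommGroup E] [NormedSpace ℂ E] [FiniteDimensional ℂ E]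
  {M : Type*} [TopologicalSpace M] [ChartedSpace E M] [IsManifold 𝓘(ℂ, E) ω M]
  {g : Metric E M} {u : ℂ → M}

theorem continuousOn_radial_deriv (hu : ContMDiffOn 𝓘(ℝ, ℂ) 𝓘(ℝ, E) ∞ u (closedBall 0 1)) :
    ContinuousOn (fun z => fderivWithin ℝ (rotEnergy g u) (closedBall 0 1) z z)
      (closedBall 0 1) :=
  ((contDiffOn_rotEnergy g hu).continuousOn_fderivWithin uniqueDiffOn_closedDisc
    (by simp)).clm_apply continuousOn_id

/-- The radial derivative of the rotational energy on the boundary of the disc. -/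
theorem radial_deriv_rotEnergy_boundary (hg : IsKahler g)
    (hu : ContMDiffOn 𝓘(ℝ, ℂ) 𝓘(ℝ, E) ∞ u (closedBall 0 1))
    (hol : MDifferentiableOn 𝓘(ℂ, ℂ) 𝓘(ℂ, E) u (ball 0 1)) (p : M) {z : ℂ}
    (hz : z ∈ sphere (0 : ℂ) 1) (hp : u z ∈ (chartAt E p).source) :
    fderivWithin ℝ (rotEnergy g u) (closedBall 0 1) z z
      = 2 * metricInChart g p (extChartAt 𝓘(ℝ, E) p (u z)) (rotAccel g u p z)
        (Complex.I • rotDeriv (extChartAt 𝓘(ℝ, E) p ∘ u) z) := by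
  have hzS := Metric.sphere_subset_closedBall hz
  have hv := contDiffWithinAt_chart_comp hu p hzS hp
  have hX := contDiffWithinAt_rotDeriv hzS hv
  have hXX := contDiffWithinAt_rotDeriv hzS hX
  have hy := (isOpen_chart_target p).mem_nhds (chart_mem_target p hp)
  have hG : ContinuousWithinAt (fun z => metricInChart g p (extChartAt 𝓘(ℝ, E) p (u z)))
      (closedBall 0 1) z :=
    ContinuousAt.comp_continuousWithinAt (g := metricInChart g p) (f := extChartAt 𝓘(ℝ, E) p ∘ u)
    ((contDiffOn_metricInChart g p).contDiffAt hy).continuousAt hv.continuousWithinAt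
  have hΓ : ContinuousWithinAt (fun z => connection g p (extChartAt 𝓘(ℝ, E) p (u z)))
      (closedBall 0 1) z :=
    ContinuousAt.comp_continuousWithinAt (g := connection g p) (f := extChartAt 𝓘(ℝ, E) p ∘ u)
    ((contDiffOn_connection g p).contDiffAt hy).continuousAt hv.continuousWithinAt
  have hX' := hX.continuousWithinAt
  have hA : ContinuousWithinAt (rotAccel g u p) (closedBall 0 1) z :=
    hXX.continuousWithinAt.add ((hΓ.clm_apply hX').clm_apply hX')
  have hR := (((hG.clm_apply hA).clm_apply (hX'.const_smul Complex.I)).const_mul 2).mono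
    Metric.ball_subset_closedBall
  have hL := (continuousOn_radial_deriv (g := g) hu z hzS).mono Metric.ball_subset_closedBall
  have hne : (nhdsWithin z (ball 0 1)).NeBot := by
    rw [← mem_closure_iff_nhdsWithin_neBot, closure_ball _ one_ne_zero]
    exact hzS
  have hz0 : z ≠ 0 := by
    rintro rfl
    simp at hz
  -- `u` is holomorphic only inside, so the formula is carried to the circle as a limit: both sides
  -- are continuous on the closed disc near `z` and agree in the interior.
  refine tendsto_nhds_unique hL.tendsto (hR.tendsto.congr' ?_)
  filter_upwards [nhdsWithin_mono z Metric.ball_subset_closedBall (eventually_mem_chart hu p hzS hp),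
    self_mem_nhdsWithin, nhdsWithin_le_nhds (isOpen_ne.mem_nhds hz0)] with z' h1 h2 h3
  exact (radial_deriv_rotEnergy hg hu hol p h2 h3 h1).symm

variable {F : Type*} [NormedAddCommGroup F] [NormedSpace ℝ F]
  {L : Type*} [TopologicalSpace L] [ChartedSpace F L] {ι : L → M}

/-- The expression of `ι` in the preferred charts at `q` and `ι q`. -/
def immersionInCharts (F : Type*) [NormedAddCommGroup F] [NormedSpace ℝ F] [ChartedSpace F L]
    (ι : L → M) (q : L) : F → E :=
  extChartAt 𝓘(ℝ, E) (ι q) ∘ ι ∘ (extChartAt 𝓘(ℝ, F) q).symm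

omit [FiniteDimensional ℂ E] [IsManifold 𝓘(ℂ, E) ω M] in
theorem mfderiv_eq_fderiv_immersionInCharts {q : L}
    (h : MDifferentiableAt 𝓘(ℝ, F) 𝓘(ℝ, E) ι q) (c : F) :
    (mfderiv 𝓘(ℝ, F) 𝓘(ℝ, E) ι q c : E)
      = fderiv ℝ (immersionInCharts (E := E) F ι q) (extChartAt 𝓘(ℝ, F) q q) c := by
  have h1 : (mfderiv 𝓘(ℝ, F) 𝓘(ℝ, E) ι q : F →L[ℝ] E) = fderivWithin ℝ
    (immersionInCharts (E := E) F ι q) Set.univ (extChartAt 𝓘(ℝ, F) q q) := by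
    have := h.mfderiv
    simp only [writtenInExtChartAt, modelWithCornersSelf_coe, Set.range_id] at this
    exact this
  rw [fderivWithin_univ] at h1
  exact congrArg (fun A : F →L[ℝ] E => A c) h1

omit [FiniteDimensional ℂ E] in
theorem innerAt_I_smul_tangent (hLag : IsLagrangian g F ι) (q : L) (a b : F) :
    innerAt g (ι q)
      (fderiv ℝ (immersionInCharts (E := E) F ι q) (extChartAt 𝓘(ℝ, F) q q) a)
      (Complex.I • fderiv ℝ (immersionInCharts (E := E) F ι q) (extChartAt 𝓘(ℝ, F) q q) b) = 0 := by
  have h := (hLag.immersion.isImmersionAt q).contMDiffAt.mdifferentiableAt (by simp)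
  rw [innerAt_symm, ← mfderiv_eq_fderiv_immersionInCharts h, ← mfderiv_eq_fderiv_immersionInCharts h]
  exact hLag.isotropic q b a

/-- The Lagrangian condition makes `i Df(a)` normal to `L`, so it is an admissible test vector for
the second fundamental form. -/
theorem innerAt_ambientDerivative (hLag : IsLagrangian g F ι) (hgeod : IsTotallyGeodesic g F ι)
    (q : L) (a : F) :
    innerAt g (ι q)
      (fderiv ℝ (fderiv ℝ (immersionInCharts (E := E) F ι q)) (extChartAt 𝓘(ℝ, F) q q) a a
        + connection g (ι q) (extChartAt 𝓘(ℝ, E) (ι q) (ι q))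
          (fderiv ℝ (immersionInCharts (E := E) F ι q) (extChartAt 𝓘(ℝ, F) q q) a)
          (fderiv ℝ (immersionInCharts (E := E) F ι q) (extChartAt 𝓘(ℝ, F) q q) a))
      (Complex.I • fderiv ℝ (immersionInCharts (E := E) F ι q) (extChartAt 𝓘(ℝ, F) q q) a) = 0 := by
  have h := (hLag.immersion.isImmersionAt q).contMDiffAt.mdifferentiableAt (by simp)
  refine hgeod q a a (Complex.I • fderiv ℝ (immersionInCharts (E := E) F ι q)
    (extChartAt 𝓘(ℝ, F) q q) a : E) fun c => ?_
  have := innerAt_I_smul_tangent hLag q c a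
  rw [← mfderiv_eq_fderiv_immersionInCharts h c] at this
  exact this

/-- The boundary of `u` lifts smoothly along `ι` near the angle `θ`. -/
def LiftsAt (F : Type*) [NormedAddCommGroup F] [NormedSpace ℝ F] [ChartedSpace F L]
    (u : ℂ → M) (ι : L → M) (θ : ℝ) : Prop :=
  ∃ c : ℝ → L, ContMDiffAt 𝓘(ℝ, ℝ) 𝓘(ℝ, F) ∞ c θ ∧
    ∀ᶠ s : ℝ in nhds θ, ι (c s) = u (Complex.exp (s * Complex.I))

theorem exp_mul_I_mem_sphere (s : ℝ) : Complex.exp (s * Complex.I) ∈ sphere (0 : ℂ) 1 := by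
  simp [Complex.norm_exp_ofReal_mul_I]

theorem radial_deriv_eq_zero_of_liftsAt [IsManifold 𝓘(ℝ, F) ∞ L] (hg : IsKahler g)
    (hLag : IsLagrangian g F ι)
    (hgeod : IsTotallyGeodesic g F ι) (hu : ContMDiffOn 𝓘(ℝ, ℂ) 𝓘(ℝ, E) ∞ u (closedBall 0 1))
    (hol : MDifferentiableOn 𝓘(ℂ, ℂ) 𝓘(ℂ, E) u (ball 0 1)) {θ : ℝ}
    (hl : LiftsAt F u ι θ) :
    fderivWithin ℝ (rotEnergy g u) (closedBall 0 1) (Complex.exp (θ * Complex.I))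
      (Complex.exp (θ * Complex.I)) = 0 := by
  obtain ⟨c, hc, hcu⟩ := hl
  set q := c θ with hq
  set p := ι q with hp
  have hup : u (Complex.exp (θ * Complex.I)) = p := hcu.self_of_nhds.symm
  have hps : u (Complex.exp (θ * Complex.I)) ∈ (chartAt E p).source := by
    rw [hup]; exact mem_chart_source E p
  set v := extChartAt 𝓘(ℝ, E) p ∘ u with hv
  set f := immersionInCharts (E := E) F ι q with hf
  set x : ℝ → F := fun s => extChartAt 𝓘(ℝ, F) q (c s) with hx
  have hS : ∀ s : ℝ, Complex.exp (s * Complex.I) ∈ closedBall (0 : ℂ) 1 := fun s =>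
    Metric.sphere_subset_closedBall (exp_mul_I_mem_sphere s)
  have hxs : ContDiffAt ℝ ∞ x θ := by
    rw [← contMDiffAt_iff_contDiffAt]
    exact (contMDiffAt_extChartAt' (mem_chart_source F q)).comp θ hc
  have hfs : ContDiffAt ℝ ∞ f (x θ) := by
    rw [← contMDiffAt_iff_contDiffAt]
    have h1 : ContMDiffAt 𝓘(ℝ, F) 𝓘(ℝ, F) ∞ (extChartAt 𝓘(ℝ, F) q).symm (x θ) :=
      (contMDiffOn_extChartAt_symm q).contMDiffAt
        ((isOpen_extChartAt_target q).mem_nhds (mem_extChartAt_target q))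
    have h0 : (extChartAt 𝓘(ℝ, F) q).symm (x θ) = q := extChartAt_to_inv q
    have h2 : ContMDiffAt 𝓘(ℝ, F) 𝓘(ℝ, E) ∞ ι ((extChartAt 𝓘(ℝ, F) q).symm (x θ)) := by
      rw [h0]; exact (hLag.immersion.isImmersionAt q).contMDiffAt
    have h3 : ContMDiffAt 𝓘(ℝ, E) 𝓘(ℝ, E) ∞ (extChartAt 𝓘(ℝ, E) p)
        (ι ((extChartAt 𝓘(ℝ, F) q).symm (x θ))) := by
      rw [h0]; exact contMDiffAt_extChartAt' (mem_chart_source E p)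
    exact h3.comp (x θ) (h2.comp (x θ) h1)
  have hcurve : Filter.Tendsto (fun s : ℝ => Complex.exp (s * Complex.I)) (nhds θ)
      (nhdsWithin (Complex.exp (θ * Complex.I)) (closedBall 0 1)) := by
    refine tendsto_nhdsWithin_iff.2 ⟨?_, Filter.Eventually.of_forall hS⟩
    exact (by fun_prop : ContinuousAt (fun s : ℝ => Complex.exp (s * Complex.I)) θ)
  have hsrc := hcurve.eventually (eventually_mem_chart hu p (hS θ) hps)
  have hcsrc : ∀ᶠ s in nhds θ, c s ∈ (chartAt F q).source :=
    hc.continuousAt.eventually_mem ((chartAt F q).open_source.mem_nhds (mem_chart_source F q))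
  have hγ : ∀ᶠ s : ℝ in nhds θ, v (Complex.exp (s * Complex.I)) = f (x s) := by
    filter_upwards [hcu, hcsrc] with s h1 h2
    have h3 : (extChartAt 𝓘(ℝ, F) q).symm (x s) = c s :=
      (extChartAt 𝓘(ℝ, F) q).left_inv (by rwa [extChartAt_source])
    simp only [hv, hf, immersionInCharts, Function.comp_apply, h3, h1]
    rfl
  have hrot : ∀ (w : ℂ → E) (s : ℝ),
      ContDiffWithinAt ℝ ∞ w (closedBall 0 1) (Complex.exp (s * Complex.I)) →
      HasDerivAt (fun s : ℝ => w (Complex.exp (s * Complex.I)))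
        (rotDeriv w (Complex.exp (s * Complex.I))) s := by
    intro w s hw
    have := hasDerivAt_rotation (ζ := 0) le_rfl s (w := w)
      (by simpa using hw.differentiableWithinAt (by simp))
    simp only [zero_add] at this
    exact this
  have hfd : ∀ᶠ y in nhds (x θ), HasFDerivAt f (fderiv ℝ f y) y := by
    filter_upwards [(hfs.of_le (m := 1) (by simp)).eventually (by simp)] with y hy using
      (hy.differentiableAt (by simp)).hasFDerivAt
  have hxd : ∀ᶠ s in nhds θ, HasDerivAt x (deriv x s) s := by
    filter_upwards [(hxs.of_le (m := 1) (by simp)).eventually (by simp)] with s hs using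
      (hs.differentiableAt (by simp)).hasDerivAt
  have hvel : ∀ᶠ s : ℝ in nhds θ,
      rotDeriv v (Complex.exp (s * Complex.I)) = fderiv ℝ f (x s) (deriv x s) := by
    filter_upwards [hsrc, hγ.eventually_nhds, hxd, hxs.continuousAt.eventually hfd]
      with s h1 h2 h3 h4
    exact (hrot v s (contDiffWithinAt_chart_comp hu p (hS s) h1)).unique
      ((h4.comp_hasDerivAt s h3).congr_of_eventuallyEq h2)
  have hvθ := contDiffWithinAt_chart_comp hu p (hS θ) hps
  -- Second derivative of `f ∘ x`. Together with the Christoffel term, `D²f(x', x')` is the ambient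
  -- derivative, killed by total geodesy; `Df(x'')` is tangent, killed by the Lagrangian condition.
  have hacc : rotDeriv (rotDeriv v) (Complex.exp (θ * Complex.I))
      = fderiv ℝ (fderiv ℝ f) (x θ) (deriv x θ) (deriv x θ)
        + fderiv ℝ f (x θ) (deriv (deriv x) θ) := by
    have h1 : HasFDerivAt (fderiv ℝ f) (fderiv ℝ (fderiv ℝ f) (x θ)) (x θ) :=
      ((hfs.fderiv_right (m := ∞) (by simp)).differentiableAt (by simp)).hasFDerivAt
    have h2 : HasDerivAt (deriv x) (deriv (deriv x) θ) θ := by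
      have : ContDiffAt ℝ ∞ (fun s => fderiv ℝ x s 1) θ :=
        (hxs.fderiv_right (m := ∞) (by simp)).clm_apply contDiffAt_const
      exact (this.differentiableAt (by simp)).hasDerivAt
    have h3 := @HasFDerivAt.comp_hasDerivAt ℝ _ F _ _ (F →L[ℝ] E) _ _ x (deriv x θ) θ _ _ h1
      hxd.self_of_nhds
    exact (hrot _ θ (contDiffWithinAt_rotDeriv (hS θ) hvθ)).unique
      ((h3.clm_apply h2).congr_of_eventuallyEq hvel)
  rw [radial_deriv_rotEnergy_boundary hg hu hol p (exp_mul_I_mem_sphere θ) hps, rotAccel, hacc,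
    hvel.self_of_nhds, hup, metricInChart_center, add_right_comm, map_add, add_apply]
  have e1 := innerAt_ambientDerivative hLag hgeod q (deriv x θ)
  have e2 := innerAt_I_smul_tangent hLag q (deriv (deriv x) θ) (deriv x θ)
  have e3 : x θ = extChartAt 𝓘(ℝ, F) q q := rfl
  rw [e3, e1, e2]
  simp

end Boundary

/-! ### Local lifts of the boundary curve. -/

section Lift

open Metric (closedBall ball sphere)

variable {E : Type*} [NormedAddCommGroup E] [NormedSpace ℂ E]
  {M : Type*} [TopologicalSpace M] [T2Space M] [ChartedSpace E M] [IsManifold 𝓘(ℂ, E) ω M]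
  {F : Type*} [NormedAddCommGroup F] [NormedSpace ℝ F]
  {L : Type*} [TopologicalSpace L] [ChartedSpace F L] {ι : L → M} {u : ℂ → M}

omit [T2Space M] [IsManifold 𝓘(ℂ, E) ω M] in
theorem contMDiff_boundary (hu : ContMDiffOn 𝓘(ℝ, ℂ) 𝓘(ℝ, E) ∞ u (closedBall 0 1)) :
    ContMDiff 𝓘(ℝ, ℝ) 𝓘(ℝ, E) ∞ (fun s : ℝ => u (Complex.exp (s * Complex.I))) := by
  have h : ContDiff ℝ ∞ (fun s : ℝ => Complex.exp (s * Complex.I)) :=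
    (Complex.ofRealCLM.contDiff.mul contDiff_const).cexp
  exact contMDiffOn_univ.1 (hu.comp h.contMDiff.contMDiffOn fun s _ =>
    Metric.sphere_subset_closedBall (exp_mul_I_mem_sphere s))

omit [T2Space M] [IsManifold 𝓘(ℂ, E) ω M] in
/-- A smooth curve that stays in the image of a small piece of an immersion lifts. -/
theorem exists_lift_of_immersionAt {q : L} (h : Manifold.IsImmersionAt 𝓘(ℝ, F) 𝓘(ℝ, E) ∞ ι q)
    {γ : ℝ → M} {θ : ℝ} (hγ : ContMDiffAt 𝓘(ℝ, ℝ) 𝓘(ℝ, E) ∞ γ θ)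
    (him : ∀ᶠ s in nhds θ, γ s ∈ ι '' h.domChart.source) :
    ∃ c : ℝ → L, ContMDiffAt 𝓘(ℝ, ℝ) 𝓘(ℝ, F) ∞ c θ ∧ ∀ᶠ s in nhds θ, ι (c s) = γ s := by
  set y : ℝ → F := fun s => (h.equiv.symm (h.codChart (γ s))).1 with hy
  -- In adapted charts an immersion is `x ↦ (x, 0)`, so the first projection is a smooth left
  -- inverse; applied to `γ` it produces the lift.
  have key : ∀ k ∈ h.domChart.source, (h.equiv.symm (h.codChart (ι k))).1 = h.domChart k := by
    intro k hk
    have ht : h.domChart k ∈ (h.domChart.extend 𝓘(ℝ, F)).target := by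
      simpa using h.domChart.map_source hk
    have h1 := h.writtenInCharts ht
    have h2 : h.codChart (ι k) = h.equiv (h.domChart k, 0) := by
      simpa [h.domChart.left_inv hk] using h1
    rw [h2, ContinuousLinearEquiv.symm_apply_apply]
  obtain ⟨k, hk, hkθ⟩ := him.self_of_nhds
  have hyθ : y θ = h.domChart k := by simp only [hy, ← hkθ, key k hk]
  have hcod : γ θ ∈ h.codChart.source := by
    rw [← hkθ]; exact h.source_subset_preimage_source hk
  refine ⟨fun s => h.domChart.symm (y s), ?_, ?_⟩
  · have h1 : ContMDiffAt 𝓘(ℝ, ℝ) 𝓘(ℝ, E) ∞ (fun s => h.codChart (γ s)) θ :=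
      (contMDiffAt_of_mem_maximalAtlas h.codChart_mem_maximalAtlas hcod).comp θ hγ
    have h2 : ContMDiffAt 𝓘(ℝ, ℝ) 𝓘(ℝ, F) ∞ y θ := by
      rw [contMDiffAt_iff_contDiffAt] at h1 ⊢
      exact (h.equiv.symm.contDiff.contDiffAt.comp θ h1).fst
    exact (contMDiffAt_symm_of_mem_maximalAtlas h.domChart_mem_maximalAtlas
      (by rw [hyθ]; exact h.domChart.map_source hk)).comp θ h2
  · filter_upwards [him] with s hs
    obtain ⟨k', hk', hks⟩ := hs
    have : y s = h.domChart k' := by simp only [hy, ← hks, key k' hk']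
    rw [this, h.domChart.left_inv hk', hks]

-- Countably many compact pieces of `L`, each inside an immersion chart, cover `L`. Their images are
-- closed as `M` is Hausdorff, so the preimages under the boundary curve are closed and cover the
-- line. By Baire their interiors have dense union, and on each interior the curve stays in the
-- image of one chart, where it lifts.
omit [IsManifold 𝓘(ℂ, E) ω M] in
theorem dense_liftsAt [FiniteDimensional ℝ F] [SecondCountableTopology L]
    (hι : Manifold.IsImmersion 𝓘(ℝ, F) 𝓘(ℝ, E) ∞ ι)
    (hu : ContMDiffOn 𝓘(ℝ, ℂ) 𝓘(ℝ, E) ∞ u (closedBall 0 1))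
    (hb : u '' sphere 0 1 ⊆ Set.range ι) : Dense {θ : ℝ | LiftsAt F u ι θ} := by
  have : LocallyCompactSpace L := ChartedSpace.locallyCompactSpace F L
  have hex : ∀ q : L, ∃ K ∈ nhds q, K ⊆ (hι.isImmersionAt q).domChart.source ∧ IsCompact K :=
    fun q => local_compact_nhds ((hι.isImmersionAt q).domChart.open_source.mem_nhds
      (hι.isImmersionAt q).mem_domChart_source)
  choose K hKn hKs hKc using hex
  obtain ⟨t, htc, htU⟩ := TopologicalSpace.countable_cover_nhds hKn
  have hγ := contMDiff_boundary hu
  set γ : ℝ → M := fun s => u (Complex.exp (s * Complex.I)) with hγdef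
  have hιc : Continuous ι := continuous_iff_continuousAt.2 fun q => (hι.isImmersionAt q).continuousAt
  have hd : Dense (⋃ q ∈ t, interior (γ ⁻¹' (ι '' K q))) := by
    refine dense_biUnion_interior_of_closed (fun q _ =>
      (((hKc q).image hιc).isClosed.preimage hγ.continuous)) htc ?_
    refine Set.eq_univ_of_forall fun s => ?_
    obtain ⟨k, hk⟩ := hb ⟨_, exp_mul_I_mem_sphere s, rfl⟩
    have hkU : k ∈ ⋃ q ∈ t, K q := by rw [htU]; trivial
    obtain ⟨q, hq, hkq⟩ := Set.mem_iUnion₂.1 hkU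
    exact Set.mem_iUnion₂.2 ⟨q, hq, k, hkq, hk⟩
  refine hd.mono fun θ hθ => ?_
  obtain ⟨q, -, hq⟩ := Set.mem_iUnion₂.1 hθ
  refine exists_lift_of_immersionAt (hι.isImmersionAt q) hγ.contMDiffAt ?_
  filter_upwards [mem_interior_iff_mem_nhds.1 hq] with s hs
  exact Set.image_mono (hKs q) hs

end Lift

/-! ### Vanishing energy forces the disc to be constant. -/

section Conclusion

open Metric (closedBall ball sphere)

variable {E : Type*} [NormedAddCommGroup E] [NormedSpace ℂ E] [FiniteDimensional ℂ E]
  {M : Type*} [TopologicalSpace M] [T2Space M] [ChartedSpace E M] [IsManifold 𝓘(ℂ, E) ω M]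
  {g : Metric E M} {u : ℂ → M}

omit [T2Space M] in
/-- The rotational energy of a holomorphic disc with boundary on a totally geodesic Lagrangian
satisfies the Neumann condition. -/
theorem radial_deriv_eq_zero {F : Type*} [NormedAddCommGroup F] [NormedSpace ℝ F]
    {L : Type*} [TopologicalSpace L] [ChartedSpace F L] [IsManifold 𝓘(ℝ, F) ∞ L] {ι : L → M}
    (hg : IsKahler g) (hLag : IsLagrangian g F ι) (hgeod : IsTotallyGeodesic g F ι)
    (hu : ContMDiffOn 𝓘(ℝ, ℂ) 𝓘(ℝ, E) ∞ u (closedBall 0 1))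
    (hol : MDifferentiableOn 𝓘(ℂ, ℂ) 𝓘(ℂ, E) u (ball 0 1))
    (hd : Dense {θ : ℝ | LiftsAt F u ι θ}) {z : ℂ} (hz : z ∈ sphere (0 : ℂ) 1) :
    fderivWithin ℝ (rotEnergy g u) (closedBall 0 1) z z = 0 := by
  have hc : Continuous (fun s : ℝ => fderivWithin ℝ (rotEnergy g u) (closedBall 0 1)
      (Complex.exp (s * Complex.I)) (Complex.exp (s * Complex.I))) :=
    (continuousOn_radial_deriv hu).comp_continuous (f := fun s : ℝ => Complex.exp (s * Complex.I))
      (by fun_prop)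
      fun s => Metric.sphere_subset_closedBall (exp_mul_I_mem_sphere s)
  have h := hc.ext_on hd continuous_const
    (fun θ hθ => radial_deriv_eq_zero_of_liftsAt hg hLag hgeod hu hol hθ)
  have hz' : Complex.exp (z.arg * Complex.I) = z := by
    have := Complex.norm_mul_exp_arg_mul_I z
    rwa [mem_sphere_zero_iff_norm.1 hz, Complex.ofReal_one, one_mul] at this
  have := congrFun h z.arg
  simpa only [hz'] using this

omit [FiniteDimensional ℂ E] [T2Space M] in
theorem deriv_chartLift_eq_zero (hg : IsKahler g)
    (hu : ContMDiffOn 𝓘(ℝ, ℂ) 𝓘(ℝ, E) ∞ u (closedBall 0 1))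
    (hol : MDifferentiableOn 𝓘(ℂ, ℂ) 𝓘(ℂ, E) u (ball 0 1))
    (h0 : ∀ z ∈ closedBall (0 : ℂ) 1, rotEnergy g u z = 0) (p : M) {ζ : ℂ}
    (hζ : ζ ∈ chartDomain (E := E) u p) : deriv (chartLift (E := E) u p) ζ = 0 := by
  by_contra h
  have h1 := metricInChart_pos g p (mapsTo_chartLift p hζ) h
  rw [← rotEnergy_exp hg hu hol p hζ, h0 _ (exp_mem_closedBall hζ.1.le)] at h1
  exact h1.false

omit [FiniteDimensional ℂ E] in
theorem constant_of_rotEnergy_eq_zero (hg : IsKahler g)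
    (hu : ContMDiffOn 𝓘(ℝ, ℂ) 𝓘(ℝ, E) ∞ u (closedBall 0 1))
    (hol : MDifferentiableOn 𝓘(ℂ, ℂ) 𝓘(ℂ, E) u (ball 0 1))
    (h0 : ∀ z ∈ closedBall (0 : ℂ) 1, rotEnergy g u z = 0) {z : ℂ}
    (hz : z ∈ closedBall (0 : ℂ) 1) : u z = u (Complex.exp (-1)) := by
  -- `u ∘ exp` is locally constant on the connected left half plane, which `exp` maps onto the
  -- punctured open disc.
  have hH : IsPreconnected {ζ : ℂ | ζ.re < 0} := (convex_halfSpace_re_lt 0).isPreconnected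
  have hconst : ∀ ζ ∈ {ζ : ℂ | ζ.re < 0}, ∀ ξ ∈ {ζ : ℂ | ζ.re < 0},
      u (Complex.exp ζ) = u (Complex.exp ξ) := by
    intro ζ hζ ξ hξ
    refine hH.induction₂ (fun a b => u (Complex.exp a) = u (Complex.exp b)) (fun x hx => ?_)
      (fun a b c _ _ _ => Eq.trans) (fun a b _ _ => Eq.symm) hζ hξ
    set p := u (Complex.exp x) with hp
    have hO := isOpen_chartDomain hu p
    have hxO : x ∈ chartDomain (E := E) u p := ⟨hx, mem_chart_source E _⟩
    obtain ⟨r, hr, hball⟩ := Metric.isOpen_iff.1 hO x hxO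
    refine nhdsWithin_le_nhds ?_
    filter_upwards [Metric.ball_mem_nhds x hr] with y hy
    have hV : chartLift (E := E) u p x = chartLift (E := E) u p y :=
      Metric.isOpen_ball.is_const_of_deriv_eq_zero (convex_ball x r).isPreconnected
        ((differentiableOn_chartLift hol p).mono hball)
        (fun w hw => deriv_chartLift_eq_zero hg hu hol h0 p (hball hw))
        (Metric.mem_ball_self hr) hy
    exact (extChartAt 𝓘(ℝ, E) p).injOn (by rw [extChartAt_source]; exact hxO.2)
      (by rw [extChartAt_source]; exact (hball hy).2) hV
  have hpunct : ∀ w ∈ ball (0 : ℂ) 1 ∩ {0}ᶜ, u w = u (Complex.exp (-1)) := by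
    intro w hw
    have hw0 : w ≠ 0 := hw.2
    rw [← Complex.exp_log hw0]
    refine hconst _ ?_ _ (by simp)
    rw [Set.mem_ofPred_eq, Complex.log_re]
    exact Real.log_neg (norm_pos_iff.2 hw0) (mem_ball_zero_iff.1 hw.1)
  -- The centre and the boundary circle, missed by `exp`, are reached by continuity.
  have hcl : z ∈ closure (ball (0 : ℂ) 1 ∩ {0}ᶜ) := by
    have h1 := closure_mono ((dense_compl_singleton (0 : ℂ)).open_subset_closure_inter
      (Metric.isOpen_ball (x := (0 : ℂ)) (ε := 1)))
    rw [closure_closure, closure_ball _ one_ne_zero] at h1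
    exact h1 hz
  have hne := mem_closure_iff_nhdsWithin_neBot.1 hcl
  have hlim := (hu.continuousOn z hz).mono_left
    (nhdsWithin_mono z (Set.inter_subset_left.trans Metric.ball_subset_closedBall) :
      nhdsWithin z (ball (0 : ℂ) 1 ∩ {0}ᶜ) ≤ _)
  refine tendsto_nhds_unique hlim (tendsto_const_nhds.congr' ?_)
  filter_upwards [self_mem_nhdsWithin] with w hw using (hpunct w hw).symm

end Conclusion

end KahlerDisc

end

theorem mainTheorem5
    {E : Type*} [NormedAddCommGroup E] [NormedSpace ℂ E] [FiniteDimensional ℂ E]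
    {M : Type*} [TopologicalSpace M] [T2Space M] [ChartedSpace E M] [IsManifold 𝓘(ℂ, E) ω M]
    (g : KahlerDisc.Metric E M) (hg : KahlerDisc.IsKahler g)
    (hcurv : KahlerDisc.NonposSectionalCurvature g)
    {F : Type*} [NormedAddCommGroup F] [NormedSpace ℝ F] [FiniteDimensional ℝ F]
    {L : Type*} [TopologicalSpace L] [T2Space L] [SecondCountableTopology L] [ChartedSpace F L]
    [IsManifold 𝓘(ℝ, F) ∞ L]
    (ι : L → M) (hLag : KahlerDisc.IsLagrangian g F ι) (hgeod : KahlerDisc.IsTotallyGeodesic g F ι) :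
    ¬ ∃ u : ℂ → M,
      ContMDiffOn 𝓘(ℝ, ℂ) 𝓘(ℝ, E) ∞ u (Metric.closedBall 0 1) ∧
      MDifferentiableOn 𝓘(ℂ, ℂ) 𝓘(ℂ, E) u (Metric.ball 0 1) ∧
      u '' Metric.sphere 0 1 ⊆ Set.range ι ∧
      ∃ z ∈ Metric.closedBall (0 : ℂ) 1, ∃ z' ∈ Metric.closedBall (0 : ℂ) 1, u z ≠ u z' := by
  rintro ⟨u, hu, hol, hb, z, hz, z', hz', hne⟩
  have hd := KahlerDisc.dense_liftsAt hLag.immersion hu hb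
  have h0 : ∀ z ∈ Metric.closedBall (0 : ℂ) 1, KahlerDisc.rotEnergy g u z = 0 := fun z hz =>
    le_antisymm (KahlerDisc.nonpos_of_neumann
      ((KahlerDisc.contDiffOn_rotEnergy g hu).differentiableOn (by simp))
      (fun ζ hζ => KahlerDisc.exists_rotEnergy_second_derivs hg hcurv hu hol hζ)
      (KahlerDisc.rotEnergy_zero g)
      (fun z hz => KahlerDisc.radial_deriv_eq_zero hg hLag hgeod hu hol hd hz) z hz)
      (KahlerDisc.rotEnergy_nonneg g z)
  exact hne ((KahlerDisc.constant_of_rotEnergy_eq_zero hg hu hol h0 hz).trans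
    (KahlerDisc.constant_of_rotEnergy_eq_zero hg hu hol h0 hz').symm)
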